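/- All graphs are finite and simple, $\log$ is the natural logarithm, and "contains" means contains a copy as a (not necessarily induced) subgraph. A graph $H$ is $(n,e)$-unavoidable if every graph with $n$ vertices and $e$ edges contains $H$; for $0\le e\le\binom n2$ let $f(n,e)$ be the maximum number of edges of an $(n,e)$-unavoidable graph. For $0\le m\le\binom n2$ let $g(n,m)$ be the minimum number of edges of an $n$-vertex graph that contains every graph with $n$ vertices and $m$ edges. (a) There are absolute constants $c,C>0$ such that for all integers $n\ge 0$ and $e\ge 0$ for which $m=\binom n2-e$ satisfies $2\le m\le n\log n$, $$c\,\frac{m^2}{\log^2 m}\ \le\ \binom n2-f(n,e)\ \le\ C\,\frac{m^2}{\log^2 m}.$$ For every $\varepsilon>0$ there are constants $c,C>0$, depending only on $\varepsilon$, such that for all integers $n\ge 0$ and $e\ge 1$ for which $m=\binom n2-e$ satisfies $n\log n<m<n^{3/2-\varepsilon}$, $$c\,\frac{n^3\log n}{m}\ \le\ f(n,e)\ \le\ C\,\frac{n^3\log n}{m}.$$ (b) Equivalently, there are absolute constants $c,C>0$ such that for all integers $n,m$ with $2\le m\le\binom n2$ and $m\le n\log n$, $$c\,\frac{m^2}{\log^2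 m}\ \le\ g(n,m)\ \le\ C\,\frac{m^2}{\log^2 m},$$ and for every $\varepsilon>0$ there are constants $c,C>0$, depending only on $\varepsilon$, such that for all integers $n\ge 0$ and $m<\binom n2$ with $n\log n<m<n^{3/2-\varepsilon}$, $$c\,\frac{n^3\log n}{m}\ \le\ \binom n2-g(n,m)\ \le\ C\,\frac{n^3\log n}{m}.$$ (In the expressions above, $n\log n$ is read as $0$ for $n=0$.) -/

import Mathlib

open SimpleGraph

/-- The number of edges of a finite simple graph. -/
noncomputable def numEdges {V : Type*} (G : SimpleGraph V) : ℕ := G.edgeSet.ncard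

/-- A graph `H` is `(n, e)`-unavoidable if every graph on `n` vertices with `e` edges contains
a copy of `H` as a (not necessarily induced) subgraph. -/
def IsUnavoidable {W : Type*} (n e : ℕ) (H : SimpleGraph W) : Prop :=
  ∀ G : SimpleGraph (Fin n), numEdges G = e → H.IsContained G

/-- A graph `U` is `(n, m)`-universal if it contains a copy of every graph on `n` vertices
with `m` edges. -/
def IsUniversal {W : Type*} (n m : ℕ) (U : SimpleGraph W) : Prop :=
  ∀ H : SimpleGraph (Fin n), numEdges H = m → H.IsContained U

/-- The numbers of edges of `(n, e)`-unavoidable finite graphs (on any number of vertices). -/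
def unavoidableSizes (n e : ℕ) : Set ℕ :=
  {t | ∃ (k : ℕ) (H : SimpleGraph (Fin k)), IsUnavoidable n e H ∧ numEdges H = t}

/-- The numbers of edges of `(n, m)`-universal graphs on `n` vertices. -/
def universalSizes (n m : ℕ) : Set ℕ :=
  {t | ∃ U : SimpleGraph (Fin n), IsUniversal n m U ∧ numEdges U = t}

/-- `f(n, e)`: the maximum number of edges of an `(n, e)`-unavoidable graph. -/
noncomputable def unavoidMax (n e : ℕ) : ℕ := sSup (unavoidableSizes n e)

/-- `g(n, m)`: the minimum number of edges of an `(n, m)`-universal graph on `n` vertices. -/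
noncomputable def univMin (n m : ℕ) : ℕ := sInf (universalSizes n m)

theorem exists_numEdges_eq {n e : ℕ} (he : e ≤ n.choose 2) :
    ∃ G : SimpleGraph (Fin n), numEdges G = e := by
  classical
  have hc : (⊤ : SimpleGraph (Fin n)).edgeFinset.card = n.choose 2 := by
    simpa using card_edgeFinset_top_eq_card_choose_two (V := Fin n)
  obtain ⟨s, hs, hcard⟩ := Finset.exists_subset_card_eq (hc ▸ he)
  refine ⟨SimpleGraph.fromEdgeSet (s : Set (Sym2 (Fin n))), ?_⟩
  have h1 : (s : Set (Sym2 (Fin n))) \ {x | x.IsDiag} = s := by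
    ext x
    simp only [Set.mem_sdiff, Finset.mem_coe, Set.mem_ofPred_eq, and_iff_left_iff_imp]
    intro hx
    have := hs hx
    rw [mem_edgeFinset] at this
    exact not_isDiag_of_mem_edgeSet _ this
  unfold numEdges
  rw [edgeSet_fromEdgeSet]
  erw [h1]
  rw [Set.ncard_coe_finset, hcard]

/-- For `e ≤ C(n,2)` the supremum defining `unavoidMax` is a genuine maximum. -/
theorem unavoidMax_isGreatest {n e : ℕ} (he : e ≤ n.choose 2) :
    IsGreatest (unavoidableSizes n e) (unavoidMax n e) := by
  have hne : (unavoidableSizes n e).Nonempty :=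
    ⟨_, 0, ⊥, fun G _ => ⟨⟨⟨Fin.elim0, fun {a} => a.elim0⟩, fun a => a.elim0⟩⟩, rfl⟩
  have hb : BddAbove (unavoidableSizes n e) := by
    refine ⟨e, ?_⟩
    rintro t ⟨k, H, hH, rfl⟩
    obtain ⟨G, hG⟩ := exists_numEdges_eq he
    obtain ⟨φ⟩ := hH G hG
    rw [← hG]
    have hinj : Function.Injective φ.toHom.mapEdgeSet := Hom.mapEdgeSet.injective φ.toHom φ.injective
    have := Nat.card_le_card_of_injective _ hinj
    simpa only [numEdges, ← Nat.card_coe_set_eq] using this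
  exact ⟨Nat.sSup_mem hne hb, fun t ht => le_csSup hb ht⟩

/-- The infimum defining `univMin` is a genuine minimum. -/
theorem univMin_isLeast (n m : ℕ) : IsLeast (universalSizes n m) (univMin n m) :=
  ⟨Nat.sInf_mem ⟨_, ⊤, fun _ _ => IsContained.of_le le_top, rfl⟩, fun _ ht => Nat.sInf_le ht⟩

/-! Complementation on n vertices reverses containment, so g(n,m) + f(n,e) = C(n,2) when e + m =
C(n,2) (`univMin_add_unavoidMax`). It remains to bound g above and below in the first range, and f
in the second.

Lower bounds on g are counting. If U is universal, each m-edge graph on k ≤ n vertices is determined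
by the m edges of U that it uses and by a map of its vertices into the non-isolated vertices of U.
Hence C(k,2)^m ≤ (|Z|+1)^k e(U)^m whenever e(U) ≤ C(k,2) (`choose_two_pow_le`). With k about m/log m
the vertex factor is only exponential in m, so e(U) is at least a constant times k²; the condition m
≤ n log n guarantees k ≤ n. With k = n the same inequality bounds the number of non-edges of U by n³
log n / m.

Upper bounds on g come from a graph with hubs joined to everything and random layers on the other
vertices. Given H, order its vertices by decreasing degree. The first τ are left for the hubs, so
every later degree is at most P = 2m/τ. Consecutive groups are matched to the layers, each group
exceeding its layer by x(P²+1) vertices. Among that many unplaced vertices, x have disjoint sets of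
placed neighbours, and an expansion property of the random layer lets one of them enter a free slot
(`IsPartialEmbedding.exists_extension`). When fewer than y slots per layer are free, an independent
set of low-degree vertices, reserved together with its neighbourhood, fills them; all neighbours of
these vertices are sent to hubs, so no condition is violated (`isContained_of_groups`).

In the first range the layers have sizes K, 2K, 4K, … with K about m/log m and densities 8^(-g):
degrees decay fast enough for expansion, and the edge counts sum to O(K²). In the second range half
of the vertices are hubs and one layer has density 1 - 1/Q with Q about m/(n log n), which leaves
about n²/Q non-edges. The surplus of order P² must be less than n, where P is about m/n; hence the
exponent 3/2. -/

/-! ### Containment, edge counts and complement duality -/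

theorem isContained_iff_exists_injective {V W : Type*} {H : SimpleGraph W} {U : SimpleGraph V} :
    H.IsContained U ↔
      ∃ φ : W → V, Function.Injective φ ∧ ∀ a b, H.Adj a b → U.Adj (φ a) (φ b) :=
  ⟨fun ⟨f⟩ => ⟨f, f.injective, fun _ _ h => f.toHom.map_adj h⟩,
    fun ⟨φ, hi, h⟩ => ⟨⟨⟨φ, fun {a b} => h a b⟩, hi⟩⟩⟩

theorem numEdges_eq_card {V : Type*} (G : SimpleGraph V) [Fintype G.edgeSet] :
    numEdges G = G.edgeFinset.card := by
  rw [numEdges, Set.ncard_eq_toFinset_card', edgeFinset]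

theorem card_edgeFinset_top_fin (n : ℕ) :
    (⊤ : SimpleGraph (Fin n)).edgeFinset.card = n.choose 2 := by
  rw [card_edgeFinset_top_eq_card_choose_two, Fintype.card_fin]

theorem numEdges_add_compl {n : ℕ} (G : SimpleGraph (Fin n)) :
    numEdges G + numEdges Gᶜ = n.choose 2 := by
  classical
  rw [← card_edgeFinset_top_fin, ← numEdges_eq_card, ← sup_compl_eq_top (x := G)]
  unfold numEdges
  rw [edgeSet_sup, Set.ncard_union_eq (by rw [disjoint_edgeSet]; exact disjoint_compl_right)]

theorem numEdges_le_choose {n : ℕ} (G : SimpleGraph (Fin n)) : numEdges G ≤ n.choose 2 :=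
  (Nat.le_add_right _ _).trans (numEdges_add_compl G).le

theorem numEdges_map {V W : Type*} (f : V ↪ W) (G : SimpleGraph V) :
    numEdges (G.map f) = numEdges G := by
  rw [numEdges, numEdges, edgeSet_map]
  exact Set.ncard_image_of_injective _ f.sym2Map.injective

theorem numEdges_le_of_isContained {n : ℕ} {W : Type*} {H : SimpleGraph W}
    {U : SimpleGraph (Fin n)} (h : H.IsContained U) : numEdges H ≤ numEdges U := by
  obtain ⟨φ⟩ := h
  have := Nat.card_le_card_of_injective _ (Hom.mapEdgeSet.injective φ.toHom φ.injective)
  simpa only [numEdges, ← Nat.card_coe_set_eq] using this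

/-- For graphs on the same finite vertex set, containment is reversed by complementation. -/
theorem isContained_compl {n : ℕ} {G H : SimpleGraph (Fin n)} (h : G.IsContained H) :
    Hᶜ.IsContained Gᶜ := by
  rw [isContained_iff_exists_injective] at h ⊢
  obtain ⟨φ, hφ, h⟩ := h
  let e : Fin n ≃ Fin n := Equiv.ofBijective φ (Finite.injective_iff_bijective.mp hφ)
  refine ⟨e.symm, e.symm.injective, fun a b hab => ?_⟩
  rw [compl_adj] at hab ⊢
  refine ⟨e.symm.injective.ne hab.1, fun hG => hab.2 ?_⟩
  have := h _ _ hG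
  rwa [show φ (e.symm a) = a from e.apply_symm_apply a,
    show φ (e.symm b) = b from e.apply_symm_apply b] at this

theorem univMin_le {n m : ℕ} {U : SimpleGraph (Fin n)} (h : IsUniversal n m U) :
    univMin n m ≤ numEdges U := (univMin_isLeast n m).2 ⟨U, h, rfl⟩

theorem univMin_le_choose (n m : ℕ) : univMin n m ≤ n.choose 2 := by
  obtain ⟨U, -, hU⟩ := (univMin_isLeast n m).1
  exact hU ▸ numEdges_le_choose U

/-- The complement of a universal graph is unavoidable. Conversely, an unavoidable graph fits on n
vertices because some graph with e edges contains it; padded to n vertices and complemented, it is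
universal. -/
theorem univMin_add_unavoidMax {n e m : ℕ} (h : e + m = n.choose 2) :
    univMin n m + unavoidMax n e = n.choose 2 := by
  have he : e ≤ n.choose 2 := by omega
  apply le_antisymm
  · obtain ⟨k, F, hF, hFe⟩ := (unavoidMax_isGreatest he).1
    obtain ⟨G₀, hG₀⟩ := exists_numEdges_eq he
    obtain ⟨ι, hι, -⟩ := isContained_iff_exists_injective.mp (hF G₀ hG₀)
    let ι' : Fin k ↪ Fin n := ⟨ι, hι⟩
    have huniv : IsUniversal n m (F.map ι')ᶜ := by
      intro H hH
      have hHc : numEdges Hᶜ = e := by have := numEdges_add_compl H; omega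
      rw [← compl_compl H]
      apply isContained_compl
      obtain ⟨ψ, hψ, hadj⟩ := isContained_iff_exists_injective.mp (hF Hᶜ hHc)
      classical
      -- `Function.invFun` needs a nonempty domain; on an empty one the padded graph has no edges.
      rcases isEmpty_or_nonempty (Fin k) with hk | hk
      · refine isContained_iff_exists_injective.mpr ⟨id, Function.injective_id, fun a b hab => ?_⟩
        rw [SimpleGraph.map_adj] at hab
        obtain ⟨u, -⟩ := hab
        exact hk.elim u
      have hinv := Function.leftInverse_invFun hι
      -- The copy of F in the complement of H is extended to a permutation of the n vertices, so
      -- that the isolated padding is placed too.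
      obtain ⟨g, hg⟩ := Finset.exists_equiv_extend_of_card_eq (α := Fin n) (β := Fin n)
        (t := Finset.univ) (by simp) (s := Finset.univ.image ι)
        (f := fun x => ψ (Function.invFun ι x)) (Finset.subset_univ _) (by
          intro x hx y hy hxy
          simp only [Finset.coe_image, Finset.coe_univ, Set.image_univ, Set.mem_range] at hx hy
          obtain ⟨a, rfl⟩ := hx
          obtain ⟨b, rfl⟩ := hy
          have := hψ hxy
          rw [hinv a, hinv b] at this
          rw [this])
      refine isContained_iff_exists_injective.mpr
        ⟨fun x => (g x : Fin n), fun x y hxy => g.injective (Subtype.ext hxy), fun a b hab => ?_⟩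
      rw [SimpleGraph.map_adj] at hab
      obtain ⟨u, v, huv, rfl, rfl⟩ := hab
      have hu := hg (ι u) (by simp)
      have hv := hg (ι v) (by simp)
      rw [hinv u] at hu
      rw [hinv v] at hv
      change Hᶜ.Adj (g (ι u) : Fin n) (g (ι v) : Fin n)
      rw [hu, hv]
      exact hadj _ _ huv
    have h1 := univMin_le huniv
    have h2 := numEdges_add_compl (F.map ι')
    rw [numEdges_map] at h2
    omega
  · obtain ⟨U, hU, hUe⟩ := (univMin_isLeast n m).1
    have hun : IsUnavoidable n e Uᶜ := by
      intro G hG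
      have hGc : numEdges Gᶜ = m := by have := numEdges_add_compl G; omega
      rw [← compl_compl G]
      exact isContained_compl (hU _ hGc)
    have h1 := (unavoidMax_isGreatest he).2 ⟨n, Uᶜ, hun, rfl⟩
    have h2 := numEdges_add_compl U
    omega

/-! ### Isolated vertices, the counting inequality and independent sets -/

/-- The non-isolated vertices of a finite graph number at most twice the edges. -/
theorem exists_support_finset {n : ℕ} (H : SimpleGraph (Fin n)) :
    ∃ S : Finset (Fin n), S.card ≤ 2 * numEdges H ∧ ∀ a b, H.Adj a b → a ∈ S := by
  classical
  refine ⟨H.edgeFinset.biUnion fun e => e.toFinset, ?_, fun a b hab => ?_⟩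
  · rw [numEdges_eq_card, mul_comm]
    refine Finset.card_biUnion_le_card_mul _ _ _ fun e _ => ?_
    exact (Sym2.card_toFinset e).trans_le (by split_ifs <;> simp)
  · rw [Finset.mem_biUnion]
    exact ⟨s(a, b), by simpa using hab, by simp⟩

/-- Adding isolated vertices to a universal graph. -/
theorem univMin_le_of_le {n n' m : ℕ} (h1 : 2 * m ≤ n') (h2 : n' ≤ n) :
    univMin n m ≤ univMin n' m := by
  classical
  obtain ⟨U, hU, hUe⟩ := (univMin_isLeast n' m).1
  rw [← hUe, ← numEdges_map (Fin.castLEEmb h2) U]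
  apply univMin_le
  intro H hH
  obtain ⟨S₀, hS₀, hsupp⟩ := exists_support_finset H
  -- At most 2m ≤ n' vertices of H are non-isolated, so a set of exactly n' vertices carries all its
  -- edges.
  obtain ⟨S, hSS, hScard⟩ := Finset.exists_superset_card_eq (s := S₀) (n := n') (by omega)
    (by simpa using h2)
  let e : Fin n' ≃ S := (Finset.equivFinOfCardEq hScard).symm
  let emb : Fin n' ↪ Fin n := e.toEmbedding.trans (Function.Embedding.subtype _)
  have hmap : (H.comap emb).map emb = H := by
    ext a b
    rw [SimpleGraph.map_adj]
    constructor
    · rintro ⟨u, v, huv, rfl, rfl⟩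
      exact huv
    · intro hab
      have ha := hSS (hsupp a b hab)
      have hb := hSS (hsupp b a hab.symm)
      have h1 : emb (e.symm ⟨a, ha⟩) = a := by simp [emb]
      have h2 : emb (e.symm ⟨b, hb⟩) = b := by simp [emb]
      exact ⟨e.symm ⟨a, ha⟩, e.symm ⟨b, hb⟩, by rw [SimpleGraph.comap_adj, h1, h2]; exact hab,
        h1, h2⟩
  have hcount : numEdges (H.comap emb) = m := by
    rw [← numEdges_map emb, hmap, hH]
  obtain ⟨ψ, hψ, hadj⟩ := isContained_iff_exists_injective.mp (hU _ hcount)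
  have hex : ∃ f : Fin n → Fin n, ∀ i, f (emb i) = Fin.castLEEmb h2 (ψ i) := by
    refine ⟨Function.extend emb (fun i => Fin.castLEEmb h2 (ψ i)) id, fun i => ?_⟩
    exact emb.injective.extend_apply _ _ _
  obtain ⟨f, hf⟩ := hex
  obtain ⟨g, hg⟩ := Finset.exists_equiv_extend_of_card_eq (α := Fin n) (β := Fin n)
    (t := Finset.univ) (by simp) (s := Finset.univ.image emb) (f := f) (Finset.subset_univ _) (by
      intro x hx y hy hxy
      simp only [Finset.coe_image, Finset.coe_univ, Set.image_univ, Set.mem_range] at hx hy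
      obtain ⟨a, rfl⟩ := hx
      obtain ⟨b, rfl⟩ := hy
      rw [hf, hf] at hxy
      rw [hψ ((Fin.castLEEmb h2).injective hxy)])
  refine isContained_iff_exists_injective.mpr
    ⟨fun x => (g x : Fin n), fun x y hxy => g.injective (Subtype.ext hxy), fun a b hab => ?_⟩
  rw [← hmap, SimpleGraph.map_adj] at hab
  obtain ⟨u, v, huv, rfl, rfl⟩ := hab
  have hu := hg (emb u) (by simp)
  have hv := hg (emb v) (by simp)
  change (U.map _).Adj (g (emb u) : Fin n) (g (emb v) : Fin n)
  rw [hu, hv, hf, hf, SimpleGraph.map_adj]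
  exact ⟨_, _, hadj _ _ huv, rfl, rfl⟩

/-- A counting bound for universal graphs: the `m`-edge graphs on `k` vertices are encoded by
`m`-element sets of edges of `U` together with partial maps into its non-isolated vertices. -/
theorem choose_le_of_isUniversal {n m k : ℕ} (hk : k ≤ n) {U : SimpleGraph (Fin n)}
    (hU : IsUniversal n m U) (Z : Finset (Fin n)) (hZ : ∀ a b, U.Adj a b → a ∈ Z) :
    (k.choose 2).choose m ≤ (Z.card + 1) ^ k * (numEdges U).choose m := by
  classical
  let E : Finset (Sym2 (Fin k)) := (⊤ : SimpleGraph (Fin k)).edgeFinset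
  have hE : E.card = k.choose 2 := card_edgeFinset_top_fin k
  let ι : Fin k ↪ Fin n := Fin.castLEEmb hk
  have key : ∀ S, ∃ φ : Fin k → Fin n, S ∈ E.powersetCard m → Function.Injective φ ∧
      ∀ e ∈ S, Sym2.map φ e ∈ U.edgeFinset := by
    intro S
    by_cases hS : S ∈ E.powersetCard m
    swap
    · exact ⟨ι, fun h => absurd h hS⟩
    rw [Finset.mem_powersetCard] at hS
    let H₀ : SimpleGraph (Fin k) := SimpleGraph.fromEdgeSet (S : Set (Sym2 (Fin k)))
    have hH₀ : H₀.edgeSet = S := by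
      rw [edgeSet_fromEdgeSet]
      ext e
      simp only [Set.mem_sdiff, Finset.mem_coe]
      refine ⟨fun h => h.1, fun h => ⟨h, ?_⟩⟩
      have := hS.1 h
      rw [mem_edgeFinset] at this
      exact not_isDiag_of_mem_edgeSet _ this
    have hcard : numEdges (H₀.map ι) = m := by
      rw [numEdges_map, numEdges, hH₀, Set.ncard_coe_finset, hS.2]
    obtain ⟨φ, hφ, hadj⟩ := isContained_iff_exists_injective.mp (hU _ hcard)
    refine ⟨fun i => φ (ι i), fun _ => ⟨hφ.comp ι.injective, fun e he => ?_⟩⟩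
    have he' : e ∈ H₀.edgeSet := by rw [hH₀]; exact he
    induction e with
    | _ a b =>
      rw [mem_edgeSet] at he'
      rw [Sym2.map_mk, mem_edgeFinset, mem_edgeSet]
      exact hadj _ _ (by rw [SimpleGraph.map_adj]; exact ⟨a, b, he', rfl, rfl⟩)
  choose φ hφ' using key
  have hφ := fun S hS => (hφ' S hS).1
  have hφU := fun S hS => (hφ' S hS).2
  -- All isolated vertices of U are collapsed to `none`, so the number of codes depends on |Z| and
  -- not on n.
  let toZ : Fin n → Option Z := fun v => if h : v ∈ Z then some ⟨v, h⟩ else none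
  have htoZ : ∀ v w, toZ v = toZ w → w ∈ Z → v = w := by
    intro v w h hw
    by_cases hv : v ∈ Z
    · simpa [toZ, hv, hw] using h
    · simp [toZ, hv, hw] at h
  let code : Finset (Sym2 (Fin k)) → (Fin k → Option Z) × Finset (Sym2 (Fin n)) :=
    fun S => (fun i => toZ (φ S i), S.image (Sym2.map (φ S)))
  -- Decoding: the ends of an image edge are non-isolated in U, and there `toZ` loses nothing, so
  -- the code determines S.
  have hrec : ∀ S ∈ E.powersetCard m, ∀ e, e ∈ S ↔ ∃ t ∈ S.image (Sym2.map (φ S)),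
      Sym2.map (fun i => toZ (φ S i)) e = Sym2.map toZ t := by
    intro S hS e
    constructor
    · intro he
      refine ⟨_, Finset.mem_image_of_mem _ he, ?_⟩
      rw [Sym2.map_map]
      rfl
    · rintro ⟨t, ht, hte⟩
      obtain ⟨e', he', rfl⟩ := Finset.mem_image.mp ht
      have hU' := hφU S hS e' he'
      have : e = e' := by
        induction e with
        | _ a b =>
          induction e' with
          | _ c d =>
            rw [Sym2.map_mk, mem_edgeFinset, mem_edgeSet] at hU'
            have hc := hZ _ _ hU'
            have hd := hZ _ _ hU'.symm
            simp only [Sym2.map_mk, Sym2.eq_iff] at hte ⊢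
            rcases hte with ⟨h1, h2⟩ | ⟨h1, h2⟩
            · exact Or.inl ⟨hφ S hS (htoZ _ _ h1 hc), hφ S hS (htoZ _ _ h2 hd)⟩
            · exact Or.inr ⟨hφ S hS (htoZ _ _ h1 hd), hφ S hS (htoZ _ _ h2 hc)⟩
      rwa [this]
  have hinj : Set.InjOn code (E.powersetCard m : Set (Finset (Sym2 (Fin k)))) := by
    intro S hS S' hS' h
    have h1 : (fun i => toZ (φ S i)) = fun i => toZ (φ S' i) := (Prod.ext_iff.mp h).1
    have h2 : S.image (Sym2.map (φ S)) = S'.image (Sym2.map (φ S')) := (Prod.ext_iff.mp h).2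
    ext e
    rw [hrec S hS, hrec S' hS', h1, h2]
  have hmaps : Set.MapsTo code (E.powersetCard m : Set (Finset (Sym2 (Fin k))))
      ((Finset.univ ×ˢ U.edgeFinset.powersetCard m :
        Finset ((Fin k → Option Z) × Finset (Sym2 (Fin n)))) : Set _) := by
    intro S hS
    have hS' := Finset.mem_powersetCard.mp hS
    simp only [Finset.coe_product, Finset.coe_univ, Set.mem_prod, Set.mem_univ, true_and,
      Finset.mem_coe, Finset.mem_powersetCard]
    refine ⟨?_, ?_⟩
    · intro t ht
      obtain ⟨e, he, rfl⟩ := Finset.mem_image.mp ht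
      exact hφU S hS e he
    · change (S.image (Sym2.map (φ S))).card = m
      rw [Finset.card_image_of_injective _ (Sym2.map.injective (hφ S hS)), hS'.2]
  have := Finset.card_le_card_of_injOn code hmaps hinj
  rw [Finset.card_powersetCard, hE, Finset.card_product, Finset.card_powersetCard,
    ← numEdges_eq_card] at this
  simpa using this

/-- A greedy independent set for a symmetric relation of bounded degree. -/
theorem exists_independent_subset {α : Type*} [DecidableEq α] {r : α → α → Prop}
    [DecidableRel r] (hr : ∀ a b, r a b → r b a) {d : ℕ} (x : ℕ) (X : Finset α)
    (hd : ∀ v ∈ X, (X.filter (r v)).card ≤ d) (hX : x * (d + 1) ≤ X.card) :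
    ∃ I ⊆ X, I.card = x ∧ ∀ u ∈ I, ∀ v ∈ I, u ≠ v → ¬ r u v := by
  induction x generalizing X with
  | zero => exact ⟨∅, by simp, by simp, by simp⟩
  | succ x ih =>
    have hpos : 0 < X.card := lt_of_lt_of_le (by positivity) hX
    obtain ⟨v, hv⟩ := Finset.card_pos.mp hpos
    let K := insert v (X.filter (r v))
    have hK : K.card ≤ d + 1 := (Finset.card_insert_le _ _).trans (by simpa using hd v hv)
    obtain ⟨I, hI, hIc, hIr⟩ := ih (X \ K)
      (fun u hu => (Finset.card_le_card (Finset.filter_subset_filter _ Finset.sdiff_subset)).trans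
        (hd u (Finset.mem_sdiff.mp hu).1)) (by
        have := Finset.le_card_sdiff K X
        have h2 : (x + 1) * (d + 1) = x * (d + 1) + (d + 1) := by ring
        omega)
    have hI' : ∀ u ∈ I, u ∈ X ∧ u ≠ v ∧ ¬ r v u := by
      intro u hu
      have := Finset.mem_sdiff.mp (hI hu)
      refine ⟨this.1, ?_, ?_⟩
      · rintro rfl
        exact this.2 (Finset.mem_insert_self _ _)
      · exact fun h => this.2 (Finset.mem_insert_of_mem (Finset.mem_filter.mpr ⟨this.1, h⟩))
    refine ⟨insert v I, ?_, ?_, ?_⟩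
    · exact Finset.insert_subset hv fun u hu => (hI' u hu).1
    · rw [Finset.card_insert_of_notMem (fun h => (hI' v h).2.1 rfl), hIc]
    · intro a ha b hb hab
      rcases Finset.mem_insert.mp ha with rfl | ha' <;>
        rcases Finset.mem_insert.mp hb with rfl | hb'
      · exact absurd rfl hab
      · exact (hI' b hb').2.2
      · exact fun h => (hI' a ha').2.2 (hr _ _ h)
      · exact hIr a ha' b hb' hab

/-! ### Greedy embedding into groups of slots, completed by wildcards and hubs -/

section Embedding

variable {V W : Type*} [Fintype W] [DecidableEq V] [DecidableEq W]

/-- `φ` embeds the part of `H` on `S` into `U`, sending vertices of `D j` to slots in `B j`,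
and only the groups with index at most `g` are used. -/
structure IsPartialEmbedding (H : SimpleGraph W) (U : SimpleGraph V) (D : ℕ → Finset W)
    (B : ℕ → Finset V) (g : ℕ) (S : Finset W) (φ : W → V) : Prop where
  mem : ∀ w ∈ S, ∃ j ≤ g, w ∈ D j ∧ φ w ∈ B j
  injOn : ∀ a ∈ S, ∀ b ∈ S, φ a = φ b → a = b
  adj : ∀ a ∈ S, ∀ b ∈ S, H.Adj a b → U.Adj (φ a) (φ b)

/-- Among any `x` disjoint sets of at most `Δ` slots in the first groups and any `y` further slots
in the group `g`, one of the sets is completely joined to one of the slots. -/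
def GroupExpands (U : SimpleGraph V) (B : ℕ → Finset V) (x y g Δ : ℕ) : Prop :=
  ∀ (N : Fin x → Finset V) (Y : Finset V), (∀ i j, i ≠ j → Disjoint (N i) (N j)) →
    (∀ i, (N i).card ≤ Δ) → (∀ i, N i ⊆ (Finset.range (g + 1)).biUnion B) → Y ⊆ B g →
    Y.card = y → (∀ i, Disjoint (N i) Y) → ∃ i, ∃ b ∈ Y, ∀ u ∈ N i, U.Adj u b

variable {H : SimpleGraph W} [DecidableRel H.Adj] {U : SimpleGraph V} {D : ℕ → Finset W}
  {B : ℕ → Finset V}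

/-- The placed part of D g injects into B g, so at least x(P²+1) vertices of D g are unplaced. Call
two of them conflicting if they have a common placed neighbour; each conflicts with at most P²
vertices, hence x of them are pairwise free of conflict. The images of their placed neighbourhoods
are then disjoint, and expansion yields one of them together with a free slot joined to all of its
placed neighbours. -/
theorem IsPartialEmbedding.exists_extension {g : ℕ} {S : Finset W} {φ : W → V}
    (h : IsPartialEmbedding H U D B g S φ) {x y Δ P : ℕ}
    (hD : ∀ i j, i ≠ j → Disjoint (D i) (D j)) (hP : ∀ j, ∀ v ∈ D j, H.degree v ≤ P)
    (hΔ : ∀ v ∈ D g, H.degree v ≤ Δ) (hcard : (B g).card + x * (P * P + 1) ≤ (D g).card)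
    (hU : GroupExpands U B x y g Δ) (hfree : y ≤ (B g \ S.image φ).card) :
    ∃ v ∉ S, ∃ ψ, IsPartialEmbedding H U D B g (insert v S) ψ ∧ ∀ w ∈ S, ψ w = φ w := by
  have hSD : (S ∩ D g).card ≤ (B g).card := by
    refine Finset.card_le_card_of_injOn φ (fun w hw => ?_) (fun a ha b hb hab => ?_)
    · have hw := Finset.mem_inter.mp (Finset.mem_coe.mp hw)
      obtain ⟨j, -, hwj, hφ⟩ := h.mem w hw.1
      have : j = g := by
        by_contra hne
        exact Finset.disjoint_left.mp (hD j g hne) hwj hw.2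
      exact this ▸ hφ
    · exact h.injOn a (Finset.mem_inter.mp (Finset.mem_coe.mp ha)).1 b
        (Finset.mem_inter.mp (Finset.mem_coe.mp hb)).1 hab
  have hX : x * (P * P + 1) ≤ (D g \ S).card := by
    have := Finset.card_sdiff_add_card_inter (D g) S
    rw [Finset.inter_comm] at this
    omega
  classical
  obtain ⟨I, hIX, hIc, hI⟩ := exists_independent_subset
    (r := fun u v => ∃ w ∈ S, H.Adj u w ∧ H.Adj v w) (fun a b ⟨w, hw, h1, h2⟩ => ⟨w, hw, h2, h1⟩)
    x (D g \ S) (d := P * P) (fun v hv => by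
      have hsub : ((D g \ S).filter fun u => ∃ w ∈ S, H.Adj v w ∧ H.Adj u w) ⊆
          (H.neighborFinset v ∩ S).biUnion fun w => H.neighborFinset w := by
        intro u hu
        obtain ⟨-, w, hw, h1, h2⟩ := Finset.mem_filter.mp hu
        rw [Finset.mem_biUnion]
        exact ⟨w, by simp [h1, hw], by simpa using h2.symm⟩
      refine (Finset.card_le_card hsub).trans ((Finset.card_biUnion_le_card_mul _ _ P ?_).trans ?_)
      · intro w hw
        obtain ⟨j, -, hwj, -⟩ := h.mem w (Finset.mem_inter.mp hw).2
        exact hP j w hwj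
      · exact Nat.mul_le_mul_right _ ((Finset.card_le_card Finset.inter_subset_left).trans
          (hP g v (Finset.mem_sdiff.mp hv).1))) hX
  let f : Fin x ≃ I := (Finset.equivFinOfCardEq hIc).symm
  obtain ⟨Y, hY, hYc⟩ := Finset.exists_subset_card_eq hfree
  have hfD : ∀ i, (f i : W) ∈ D g ∧ (f i : W) ∉ S := fun i => Finset.mem_sdiff.mp (hIX (f i).2)
  obtain ⟨i, b, hb, hadj⟩ := hU
    (fun i => (S ∩ H.neighborFinset (f i)).image φ) Y
    (fun i j hij => by
      rw [Finset.disjoint_left]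
      intro u hu hu'
      obtain ⟨a, ha, rfl⟩ := Finset.mem_image.mp hu
      obtain ⟨a', ha', haa⟩ := Finset.mem_image.mp hu'
      rw [Finset.mem_inter, mem_neighborFinset] at ha ha'
      have := h.injOn _ ha'.1 _ ha.1 haa
      subst this
      exact hI _ (f i).2 _ (f j).2 (fun h => hij (f.injective (Subtype.ext h)))
        ⟨a', ha.1, ha.2, ha'.2⟩)
    (fun i => Finset.card_image_le.trans ((Finset.card_le_card Finset.inter_subset_right).trans
      (hΔ _ (hfD i).1)))
    (fun i u hu => by
      obtain ⟨a, ha, rfl⟩ := Finset.mem_image.mp hu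
      obtain ⟨j, hj, -, hj'⟩ := h.mem a (Finset.mem_inter.mp ha).1
      exact Finset.mem_biUnion.mpr ⟨j, Finset.mem_range.mpr (by omega), hj'⟩)
    (hY.trans Finset.sdiff_subset) hYc
    (fun i => by
      rw [Finset.disjoint_left]
      intro u hu hu'
      obtain ⟨a, ha, rfl⟩ := Finset.mem_image.mp hu
      exact (Finset.mem_sdiff.mp (hY hu')).2
        (Finset.mem_image_of_mem _ (Finset.mem_inter.mp ha).1))
  have hbB := Finset.mem_sdiff.mp (hY hb)
  have hbφ : ∀ w ∈ S, φ w ≠ b := fun w hw hwb => hbB.2 (hwb ▸ Finset.mem_image_of_mem _ hw)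
  have hnot := (hfD i).2
  refine ⟨f i, hnot, Function.update φ (f i) b, ⟨?_, ?_, ?_⟩, fun w hw =>
    Function.update_of_ne (by rintro rfl; exact hnot hw) _ _⟩
  · intro w hw
    by_cases hwi : w = f i
    · subst hwi
      exact ⟨g, le_rfl, (hfD i).1, by simpa using hbB.1⟩
    · have hwS := (Finset.mem_insert.mp hw).resolve_left hwi
      rw [Function.update_of_ne hwi]
      exact h.mem w hwS
  · intro w hw w' hw' heq
    by_cases hwi : w = f i <;> by_cases hwi' : w' = f i
    · rw [hwi, hwi']
    · have hwS := (Finset.mem_insert.mp hw').resolve_left hwi'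
      rw [hwi, Function.update_self, Function.update_of_ne hwi'] at heq
      exact absurd heq.symm (hbφ _ hwS)
    · have hwS := (Finset.mem_insert.mp hw).resolve_left hwi
      rw [hwi', Function.update_self, Function.update_of_ne hwi] at heq
      exact absurd heq (hbφ _ hwS)
    · rw [Function.update_of_ne hwi, Function.update_of_ne hwi'] at heq
      exact h.injOn _ ((Finset.mem_insert.mp hw).resolve_left hwi) _
        ((Finset.mem_insert.mp hw').resolve_left hwi') heq
  · intro w hw w' hw' hww
    by_cases hwi : w = f i <;> by_cases hwi' : w' = f i
    · rw [hwi, hwi'] at hww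
      exact absurd hww (H.irrefl)
    · have hwS := (Finset.mem_insert.mp hw').resolve_left hwi'
      rw [hwi, Function.update_self, Function.update_of_ne hwi']
      refine (hadj _ (Finset.mem_image_of_mem _ ?_)).symm
      rw [Finset.mem_inter, mem_neighborFinset]
      exact ⟨hwS, hwi ▸ hww⟩
    · have hwS := (Finset.mem_insert.mp hw).resolve_left hwi
      rw [hwi', Function.update_self, Function.update_of_ne hwi]
      refine hadj _ (Finset.mem_image_of_mem _ ?_)
      rw [Finset.mem_inter, mem_neighborFinset]
      exact ⟨hwS, hwi' ▸ hww.symm⟩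
    · rw [Function.update_of_ne hwi, Function.update_of_ne hwi']
      exact h.adj _ ((Finset.mem_insert.mp hw).resolve_left hwi) _
        ((Finset.mem_insert.mp hw').resolve_left hwi') hww

/-- Greedy placement leaves fewer than `y` free slots in each group. -/
theorem exists_partialEmbedding {x y P G : ℕ} {Δ : ℕ → ℕ}
    (hD : ∀ i j, i ≠ j → Disjoint (D i) (D j))
    (hP : ∀ j, ∀ v ∈ D j, H.degree v ≤ P)
    (hΔ : ∀ g < G, ∀ v ∈ D g, H.degree v ≤ Δ g)
    (hcard : ∀ g < G, (B g).card + x * (P * P + 1) ≤ (D g).card)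
    (hU : ∀ g < G, GroupExpands U B x y g (Δ g)) [Nonempty V] :
    ∃ S φ, IsPartialEmbedding H U D B G S φ ∧ (∀ w ∈ S, ∃ j < G, w ∈ D j) ∧
      ∀ g < G, (B g \ S.image φ).card < y := by
  induction G with
  | zero =>
    exact ⟨∅, fun _ => Classical.arbitrary V, ⟨by simp, by simp, by simp⟩, by simp, by simp⟩
  | succ g ih =>
    obtain ⟨S₀, φ₀, h₀, hS₀, hfree₀⟩ := ih (fun j hj => hΔ j (by omega))
      (fun j hj => hcard j (by omega)) (fun j hj => hU j (by omega))
    by_contra hcon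
    push Not at hcon
    -- Extensions keep earlier images, so groups below g stay nearly full and any failure occurs in
    -- group g. If it always occurred, the embedding could grow past the number of vertices of H.
    have key : ∀ t : ℕ, ∃ S φ, IsPartialEmbedding H U D B g S φ ∧ t ≤ S.card ∧
        ∀ j < g, (B j \ S.image φ).card < y := by
      intro t
      induction t with
      | zero => exact ⟨S₀, φ₀, h₀, by simp, hfree₀⟩
      | succ t iht =>
        obtain ⟨S, φ, hS, ht, hfree⟩ := iht
        have hS' : IsPartialEmbedding H U D B (g + 1) S φ :=
          ⟨fun w hw => (hS.mem w hw).imp fun j hj => ⟨by omega, hj.2⟩, hS.injOn, hS.adj⟩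
        obtain ⟨j, hj, hjy⟩ := hcon S φ hS' fun w hw =>
          (hS.mem w hw).imp fun j hj => ⟨by omega, hj.2.1⟩
        have hjg : j = g := by
          by_contra hne
          exact absurd (hfree j (by omega)) (by omega)
        subst hjg
        obtain ⟨v, hv, ψ, hψ, hext⟩ := hS.exists_extension hD hP (hΔ j hj) (hcard j hj)
          (hU j hj) hjy
        refine ⟨_, ψ, hψ, by rw [Finset.card_insert_of_notMem hv]; omega, fun i hi =>
          (Finset.card_le_card (Finset.sdiff_subset_sdiff le_rfl fun b hb => ?_)).trans_lt
            (hfree i hi)⟩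
        obtain ⟨w, hw, rfl⟩ := Finset.mem_image.mp hb
        exact Finset.mem_image.mpr ⟨w, Finset.mem_insert_of_mem hw, hext w hw⟩
    obtain ⟨S, -, -, hS, -⟩ := key (Fintype.card W + 1)
    exact absurd (Finset.card_le_univ S) (by omega)

variable [Fintype V]

/-- A spanning embedding: the vertices of `I`, whose neighbours are sent to the hubs `A`, fill the
slots left free by the greedy placement. -/
theorem isContained_of_groups {x y P G : ℕ} {Δ : ℕ → ℕ} {A : Finset V} {I : Finset W}
    (hVW : Fintype.card W = Fintype.card V)
    (hA : ∀ a ∈ A, ∀ b, b ≠ a → U.Adj a b) (hcover : ∀ v, v ∈ A ∨ ∃ g < G, v ∈ B g)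
    (hD : ∀ i j, i ≠ j → Disjoint (D i) (D j))
    (hI : ∀ v ∈ I, ∀ w, H.Adj v w → w ∉ I ∧ ∀ j, w ∉ D j) (hID : ∀ v ∈ I, ∀ j, v ∉ D j)
    (hIcard : G * y ≤ I.card)
    (hP : ∀ j, ∀ v ∈ D j, H.degree v ≤ P)
    (hΔ : ∀ g < G, ∀ v ∈ D g, H.degree v ≤ Δ g)
    (hcard : ∀ g < G, (B g).card + x * (P * P + 1) ≤ (D g).card)
    (hU : ∀ g < G, GroupExpands U B x y g (Δ g)) : H.IsContained U := by
  rcases isEmpty_or_nonempty V with hV | hV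
  · have hW : IsEmpty W := by
      rw [← Fintype.card_eq_zero_iff, hVW, Fintype.card_eq_zero_iff]
      exact hV
    exact isContained_iff_exists_injective.mpr
      ⟨fun w => hW.elim w, fun w => hW.elim w, fun w => hW.elim w⟩
  obtain ⟨S, φ, hS, hSD, hfree⟩ := exists_partialEmbedding hD hP hΔ hcard hU
  -- The free slots outside the hubs; there are at most G · y of them, so `I` can fill them all.
  let E : Finset V := Finset.univ \ (A ∪ S.image φ)
  have hE : E.card ≤ I.card := by
    have hsub : E ⊆ (Finset.range G).biUnion fun j => B j \ S.image φ := by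
      intro v hv
      have hv := Finset.mem_sdiff.mp hv
      rw [Finset.mem_union, not_or] at hv
      obtain ⟨g, hg, hvg⟩ := (hcover v).resolve_left hv.2.1
      exact Finset.mem_biUnion.mpr
        ⟨g, Finset.mem_range.mpr hg, Finset.mem_sdiff.mpr ⟨hvg, hv.2.2⟩⟩
    refine (Finset.card_le_card hsub).trans ((Finset.card_biUnion_le_card_mul _ _ y
      fun j hj => (hfree j (Finset.mem_range.mp hj)).le).trans ?_)
    simpa using hIcard
  obtain ⟨I', hI', hI'c⟩ := Finset.exists_subset_card_eq hE
  let e : I' ≃ E := Finset.equivOfCardEq hI'c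
  have hIS : ∀ v ∈ I', v ∉ S := fun v hv hvS => by
    obtain ⟨j, -, hj⟩ := hSD v hvS
    exact hID v (hI' hv) j hj
  have hEφ : ∀ v ∈ E, ∀ w ∈ S, v ≠ φ w := fun v hv w hw hvw =>
    (Finset.mem_sdiff.mp hv).2 (Finset.mem_union_right _ (hvw ▸ Finset.mem_image_of_mem _ hw))
  let f : W → V := fun w => if h : w ∈ I' then (e ⟨w, h⟩ : V) else φ w
  have hf1 : ∀ w (h : w ∈ I'), f w = e ⟨w, h⟩ := fun w h => dif_pos h
  have hf2 : ∀ w ∈ S, f w = φ w := fun w h => dif_neg fun h' => hIS w h' h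
  obtain ⟨g, hg⟩ := Finset.exists_equiv_extend_of_card_eq (α := W) (β := V)
    (t := Finset.univ) (by simpa using hVW) (s := I' ∪ S) (f := f) (Finset.subset_univ _) (by
      intro a ha b hb hab
      rcases Finset.mem_union.mp (Finset.mem_coe.mp ha) with ha | ha <;>
        rcases Finset.mem_union.mp (Finset.mem_coe.mp hb) with hb | hb
      · rw [hf1 a ha, hf1 b hb] at hab
        exact congrArg Subtype.val (e.injective (Subtype.ext hab))
      · rw [hf1 a ha, hf2 b hb] at hab
        exact absurd hab (hEφ _ (e ⟨a, ha⟩).2 _ hb)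
      · rw [hf2 a ha, hf1 b hb] at hab
        exact absurd hab.symm (hEφ _ (e ⟨b, hb⟩).2 _ ha)
      · rw [hf2 a ha, hf2 b hb] at hab
        exact hS.injOn a ha b hb hab)
  have hginj : Function.Injective fun w => (g w : V) :=
    fun x y hxy => g.injective (Subtype.ext hxy)
  -- Every vertex outside A is already the image of I' or of S, so injectivity sends all remaining
  -- vertices to hubs.
  have hgA : ∀ w, w ∉ I' ∪ S → (g w : V) ∈ A := by
    intro w hw
    by_contra hwA
    by_cases hwE : (g w : V) ∈ E
    · have h1 := hg (e.symm ⟨_, hwE⟩) (Finset.mem_union_left _ (e.symm ⟨_, hwE⟩).2)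
      rw [hf1 _ (e.symm ⟨_, hwE⟩).2, Subtype.coe_eta, e.apply_symm_apply] at h1
      exact hw (hginj h1 ▸ Finset.mem_union_left _ (e.symm ⟨_, hwE⟩).2)
    · have h2 : (g w : V) ∈ A ∪ S.image φ := by
        by_contra h
        exact hwE (Finset.mem_sdiff.mpr ⟨Finset.mem_univ _, h⟩)
      obtain ⟨s, hs, hsw⟩ := Finset.mem_image.mp ((Finset.mem_union.mp h2).resolve_left hwA)
      have h3 := hg s (Finset.mem_union_right _ hs)
      rw [hf2 s hs, hsw] at h3
      exact hw (hginj h3 ▸ Finset.mem_union_right _ hs)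
  have hIout : ∀ a ∈ I', ∀ b, H.Adj a b → (g b : V) ∈ A := by
    intro a ha b hab
    have hb := hI a (hI' ha) b hab
    refine hgA b fun h => ?_
    rcases Finset.mem_union.mp h with h | h
    · exact hb.1 (hI' h)
    · obtain ⟨j, -, hj⟩ := hSD b h
      exact hb.2 j hj
  refine isContained_iff_exists_injective.mpr ⟨fun w => (g w : V), hginj, fun a b hab => ?_⟩
  by_cases haA : (g a : V) ∈ A
  · exact hA _ haA _ (hginj.ne hab.ne')
  by_cases hbA : (g b : V) ∈ A
  · exact (hA _ hbA _ (hginj.ne hab.ne)).symm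
  have haS : a ∈ S := by
    refine (Finset.mem_union.mp (by_contra fun h => haA (hgA a h))).resolve_left fun h => ?_
    exact hbA (hIout a h b hab)
  have hbS : b ∈ S := by
    refine (Finset.mem_union.mp (by_contra fun h => hbA (hgA b h))).resolve_left fun h => ?_
    exact haA (hIout b h a hab.symm)
  change U.Adj (g a : V) (g b : V)
  rw [hg a (Finset.mem_union_right _ haS), hg b (Finset.mem_union_right _ hbS), hf2 a haS,
    hf2 b hbS]
  exact hS.adj a haS b hbS hab

end Embedding

/-! ### Splitting a graph by degree into wildcards and groups -/

theorem sum_degree_eq {n : ℕ} (H : SimpleGraph (Fin n)) [DecidableRel H.Adj] :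
    ∑ v, H.degree v = 2 * numEdges H := by
  rw [sum_degrees_eq_twice_card_edges, numEdges_eq_card]

/-- Wildcard vertices `I` and consecutive groups `D j` of the remaining vertices in order of
decreasing degree. -/
theorem exists_vertex_groups {n m : ℕ} (H : SimpleGraph (Fin n)) [DecidableRel H.Adj]
    (hm : numEdges H = m) {w d τ M G : ℕ} {b : ℕ → ℕ} (hd : 4 * m ≤ d * n)
    (hw : 2 * (w * (d + 1)) ≤ n)
    (hsum : τ + ∑ g ∈ Finset.range G, (b g + M) + w * (d + 1) ≤ n) :
    ∃ (I : Finset (Fin n)) (D : ℕ → Finset (Fin n)), I.card = w ∧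
      (∀ i j, i ≠ j → Disjoint (D i) (D j)) ∧
      (∀ v ∈ I, ∀ w, H.Adj v w → w ∉ I ∧ ∀ j, w ∉ D j) ∧ (∀ v ∈ I, ∀ j, v ∉ D j) ∧
      (∀ g < G, (D g).card = b g + M) ∧
      ∀ j, ∀ v ∈ D j, H.degree v * (τ + ∑ i ∈ Finset.range j, b i) ≤ 2 * m := by
  have hdeg := sum_degree_eq H
  rw [hm] at hdeg
  let X : Finset (Fin n) := Finset.univ.filter fun v => H.degree v ≤ d
  let X' : Finset (Fin n) := Finset.univ.filter fun v => ¬ H.degree v ≤ d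
  have hXX : X.card + X'.card = n := by
    simpa only [Finset.card_univ, Fintype.card_fin] using
      Finset.card_filter_add_card_filter_not (s := (Finset.univ : Finset (Fin n)))
        (fun v => H.degree v ≤ d)
  have hX' : X'.card * (d + 1) ≤ 2 * m := by
    rw [← hdeg]
    refine le_trans ?_ (Finset.sum_le_sum_of_subset (Finset.subset_univ X'))
    refine Finset.card_nsmul_le_sum X' _ (d + 1) fun v hv => ?_
    have := (Finset.mem_filter.mp hv).2
    omega
  -- Markov's inequality: d is at least twice the average degree, so at least half of the vertices
  -- have degree at most d.
  have hX'2 : 2 * X'.card ≤ n := by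
    by_contra hcon
    have : (n + 1) * (d + 1) ≤ 2 * X'.card * (d + 1) := Nat.mul_le_mul_right _ (by omega)
    nlinarith
  obtain ⟨I, hIX, hIc, hI⟩ := exists_independent_subset (r := H.Adj) (fun a b h => h.symm) w X
    (d := d) (fun v hv => le_trans (Finset.card_le_card fun u hu => by
      rw [mem_neighborFinset]
      exact (Finset.mem_filter.mp hu).2) (Finset.mem_filter.mp hv).2) (by omega)
  let K : Finset (Fin n) := I ∪ I.biUnion fun v => H.neighborFinset v
  have hK : K.card ≤ w * (d + 1) := by
    have h1 : (I.biUnion fun v => H.neighborFinset v).card ≤ I.card * d :=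
      Finset.card_biUnion_le_card_mul _ _ _ fun v hv => (Finset.mem_filter.mp (hIX hv)).2
    have h2 := Finset.card_union_le I (I.biUnion fun v => H.neighborFinset v)
    rw [hIc] at h1 h2
    change K.card ≤ _ at h2
    linarith [mul_add w d 1]
  let N := (Finset.univ \ K).card
  have hN : n ≤ N + w * (d + 1) := by
    have := Finset.le_card_sdiff K Finset.univ
    rw [Finset.card_univ, Fintype.card_fin] at this
    change n - K.card ≤ N at this
    omega
  let e₀ : Fin N ≃ (Finset.univ \ K : Finset (Fin n)) := (Finset.equivFinOfCardEq rfl).symm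
  let f : Fin N → ℕᵒᵈ := fun i => OrderDual.toDual (H.degree (e₀ i))
  let e : Fin N → Fin n := fun i => e₀ (Tuple.sort f i)
  have he : Function.Injective e := fun i j hij =>
    (Tuple.sort f).injective (e₀.injective (Subtype.ext hij))
  have hmono : ∀ i j, i ≤ j → H.degree (e j) ≤ H.degree (e i) := fun i j hij =>
    Tuple.monotone_sort f hij
  have heK : ∀ i, e i ∉ K := fun i => (Finset.mem_sdiff.mp (e₀ (Tuple.sort f i)).2).2
  -- In the order of decreasing degree, group j occupies the positions from s j up to s (j+1); the
  -- first τ positions belong to no group.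
  let s : ℕ → ℕ := fun j => τ + ∑ i ∈ Finset.range j, (b i + M)
  have hs : ∀ j, s (j + 1) = s j + (b j + M) := fun j => by
    simp only [s, Finset.sum_range_succ]
    omega
  have hsmono : Monotone s := monotone_nat_of_le_succ fun j => by rw [hs]; omega
  let R : ℕ → Finset (Fin N) := fun j => Finset.univ.filter fun i => s j ≤ i ∧ (i : ℕ) < s (j + 1)
  have hDK : ∀ j v, v ∈ (R j).image e → v ∉ K := by
    intro j v hv
    obtain ⟨i, -, rfl⟩ := Finset.mem_image.mp hv
    exact heK i
  refine ⟨I, fun j => (R j).image e, hIc, ?_, ?_, ?_, ?_, ?_⟩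
  · intro i j hij
    rw [Finset.disjoint_image he, Finset.disjoint_left]
    intro k hk hk'
    have h1 := (Finset.mem_filter.mp hk).2
    have h2 := (Finset.mem_filter.mp hk').2
    rcases lt_or_gt_of_ne hij with h | h
    · have := hsmono (show i + 1 ≤ j from h)
      omega
    · have := hsmono (show j + 1 ≤ i from h)
      omega
  · intro v hv u huv
    refine ⟨fun hu => hI v hv u hu huv.ne huv, fun j hj => hDK j u hj ?_⟩
    exact Finset.mem_union_right _ (Finset.mem_biUnion.mpr ⟨v, hv, by simpa using huv⟩)
  · exact fun v hv j hj => hDK j v hj (Finset.mem_union_left _ hv)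
  · intro g hg
    have hle : s (g + 1) ≤ N := by
      have h1 := hsmono (show g + 1 ≤ G from hg)
      have h2 : s G + w * (d + 1) ≤ n := hsum
      omega
    rw [Finset.card_image_of_injective _ he, ← Finset.card_map Fin.valEmbedding]
    have : (R g).map Fin.valEmbedding = Finset.Ico (s g) (s (g + 1)) := by
      ext k
      simp only [R, Finset.mem_map, Finset.mem_filter, Finset.mem_univ, true_and,
        Fin.valEmbedding_apply, Finset.mem_Ico]
      constructor
      · rintro ⟨i, hi, rfl⟩
        exact hi
      · intro hk
        exact ⟨⟨k, by omega⟩, hk, rfl⟩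
    rw [this, Nat.card_Ico, hs]
    omega
  · intro j v hv
    obtain ⟨i, hi, rfl⟩ := Finset.mem_image.mp hv
    have hi := (Finset.mem_filter.mp hi).2
    -- All vertices up to position i have at least the degree of v and the degrees sum to 2m. The
    -- surpluses M are simply dropped.
    have h1 : τ + ∑ k ∈ Finset.range j, b k ≤ (Finset.Iic i).card := by
      rw [Fin.card_Iic]
      have : ∑ k ∈ Finset.range j, b k ≤ ∑ k ∈ Finset.range j, (b k + M) :=
        Finset.sum_le_sum fun k _ => by omega
      have h2 : s j = τ + ∑ k ∈ Finset.range j, (b k + M) := rfl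
      omega
    rw [mul_comm]
    calc _ ≤ (Finset.Iic i).card * H.degree (e i) := Nat.mul_le_mul_right _ h1
      _ ≤ ∑ k ∈ Finset.Iic i, H.degree (e k) :=
          Finset.card_nsmul_le_sum _ _ _ fun k hk => hmono _ _ (Finset.mem_Iic.mp hk)
      _ = ∑ v ∈ (Finset.Iic i).image e, H.degree v :=
          (Finset.sum_image (f := fun v => H.degree v) fun _ _ _ _ h => he h).symm
      _ ≤ ∑ v, H.degree v := Finset.sum_le_sum_of_subset (Finset.subset_univ _)
      _ = 2 * m := hdeg

/-- Combines the degree splitting, with G · y wildcards and surplus x(P²+1), with the spanning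
embedding. A degree above P or Δ g would contradict the degree-times-position bound 2m. -/
theorem isUniversal_of_groups {n m : ℕ} {U : SimpleGraph (Fin n)} {A : Finset (Fin n)}
    {B : ℕ → Finset (Fin n)} {x y P G τ d : ℕ} {Δ : ℕ → ℕ}
    (hA : ∀ a ∈ A, ∀ b, b ≠ a → U.Adj a b) (hcover : ∀ v, v ∈ A ∨ ∃ g < G, v ∈ B g)
    (hd : 4 * m ≤ d * n) (hw : 2 * (G * y * (d + 1)) ≤ n)
    (hsum : τ + ∑ g ∈ Finset.range G, ((B g).card + x * (P * P + 1)) + G * y * (d + 1) ≤ n)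
    (hP : 2 * m < (P + 1) * τ)
    (hΔ : ∀ g < G, 2 * m < (Δ g + 1) * (τ + ∑ i ∈ Finset.range g, (B i).card))
    (hU : ∀ g < G, GroupExpands U B x y g (Δ g)) : IsUniversal n m U := by
  classical
  intro H hH
  obtain ⟨I, D, hIc, hD, hI, hID, hDc, hdeg⟩ := exists_vertex_groups H hH hd hw hsum
  refine isContained_of_groups (P := P) rfl hA hcover hD hI hID hIc.ge ?_ ?_
    (fun g hg => (hDc g hg).ge) hU
  · intro j v hv
    have h1 := hdeg j v hv
    by_contra hcon
    have h2 : (P + 1) * τ ≤ H.degree v * (τ + ∑ i ∈ Finset.range j, (B i).card) :=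
      Nat.mul_le_mul (by omega) (by omega)
    omega
  · intro g hg v hv
    have h1 := hdeg g v hv
    by_contra hcon
    have h2 := Nat.mul_le_mul_right (τ + ∑ i ∈ Finset.range g, (B i).card)
      (show Δ g + 1 ≤ H.degree v by omega)
    have := hΔ g hg
    omega

/-! ### Random colourings with expanding colour classes, by counting -/

section Coloring

variable {E : Type*} [Fintype E] [DecidableEq E] {Q : ℕ}

/-- Independence of the colours of different elements in counting form: the sum over all colourings
factorizes over the elements. -/
theorem sum_prod_indicator (hQ : 0 < Q) (S : Finset (Fin Q)) (M : Finset E) :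
    ∑ c : E → Fin Q, ∏ e ∈ M, (if c e ∈ S then (1 : ℝ) else 0) =
      (Q : ℝ) ^ Fintype.card E * ((S.card : ℝ) / Q) ^ M.card := by
  have hQ' : (Q : ℝ) ≠ 0 := by positivity
  have h1 : ∀ c : E → Fin Q, ∏ e ∈ M, (if c e ∈ S then (1 : ℝ) else 0) =
      ∏ e, (if e ∈ M then (if c e ∈ S then (1 : ℝ) else 0) else 1) := fun c => by
    rw [Finset.prod_ite_mem, Finset.univ_inter]
  simp_rw [h1]
  rw [← Fintype.piFinset_univ, ← Finset.prod_univ_sum (fun _ => Finset.univ)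
    (fun e a => if e ∈ M then (if a ∈ S then (1 : ℝ) else 0) else 1)]
  have h2 : ∀ e : E, ∑ a : Fin Q, (if e ∈ M then (if a ∈ S then (1 : ℝ) else 0) else 1) =
      Q * (if e ∈ M then (S.card : ℝ) / Q else 1) := by
    intro e
    split_ifs
    · simp
      field_simp
    · simp
  simp_rw [h2]
  rw [Finset.prod_mul_distrib, Finset.prod_ite_mem, Finset.prod_const, Finset.prod_const,
    Finset.univ_inter, Finset.card_univ]

/-- Colourings in which every one of the disjoint sets `T j` meets a colour outside `S`. -/
theorem card_colorings_le (hQ : 0 < Q) {J : Type*} [Fintype J] [DecidableEq J]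
    (T : J → Finset E) (hT : ∀ i j, i ≠ j → Disjoint (T i) (T j)) (S : Finset (Fin Q)) {t : ℕ}
    (ht : ∀ j, (T j).card ≤ t) :
    ((Finset.univ.filter fun c : E → Fin Q => ∀ j, ∃ e ∈ T j, c e ∉ S).card : ℝ) ≤
      (Q : ℝ) ^ Fintype.card E * (1 - ((S.card : ℝ) / Q) ^ t) ^ Fintype.card J := by
  have hS : (S.card : ℝ) / Q ≤ 1 := by
    rw [div_le_one (by positivity)]
    exact_mod_cast (Finset.card_le_univ S).trans (by simp)
  have hS0 : 0 ≤ (S.card : ℝ) / Q := by positivity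
  have h1 : ∀ c : E → Fin Q, (if ∀ j, ∃ e ∈ T j, c e ∉ S then (1 : ℝ) else 0) =
      ∏ j, (1 + -∏ e ∈ T j, (if c e ∈ S then (1 : ℝ) else 0)) := by
    intro c
    split_ifs with h
    · symm
      refine Finset.prod_eq_one fun j _ => ?_
      obtain ⟨e, he, hce⟩ := h j
      rw [Finset.prod_eq_zero he (by simp [hce])]
      simp
    · push Not at h
      obtain ⟨j, hj⟩ := h
      symm
      refine Finset.prod_eq_zero (Finset.mem_univ j) ?_
      rw [Finset.prod_eq_one fun e he => by simp [hj e he]]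
      simp
  -- One term of the expanded product. Disjointness of the T j merges the factors into a single
  -- product over their union, to which independence applies.
  have h2 : ∀ K : Finset J, ∑ c : E → Fin Q,
      ∏ j ∈ K, -∏ e ∈ T j, (if c e ∈ S then (1 : ℝ) else 0) =
        (Q : ℝ) ^ Fintype.card E * ∏ j ∈ K, -((S.card : ℝ) / Q) ^ (T j).card := by
    intro K
    have hdisj : (K : Set J).PairwiseDisjoint T := fun i _ j _ hij => hT i j hij
    simp_rw [Finset.prod_neg]
    rw [← Finset.mul_sum]
    simp_rw [← Finset.prod_biUnion hdisj]
    rw [sum_prod_indicator hQ, Finset.card_biUnion hdisj, Finset.prod_pow_eq_pow_sum]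
    ring
  calc _ = ∑ c : E → Fin Q, ∏ j, (1 + -∏ e ∈ T j, (if c e ∈ S then (1 : ℝ) else 0)) := by
        rw [Finset.card_filter]
        push_cast
        exact Finset.sum_congr rfl fun c _ => h1 c
    _ = (Q : ℝ) ^ Fintype.card E * ∏ j, (1 + -((S.card : ℝ) / Q) ^ (T j).card) := by
        simp_rw [Finset.prod_one_add]
        rw [Finset.sum_comm, Finset.mul_sum]
        exact Finset.sum_congr rfl fun K _ => h2 K
    _ ≤ (Q : ℝ) ^ Fintype.card E * ∏ _j : J, (1 - ((S.card : ℝ) / Q) ^ t) := by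
        refine mul_le_mul_of_nonneg_left (Finset.prod_le_prod (fun j _ => ?_) fun j _ => ?_)
          (by positivity)
        · have := pow_le_one₀ (n := (T j).card) hS0 hS
          linarith
        · have := pow_le_pow_of_le_one hS0 hS (ht j)
          linarith
    _ = _ := by rw [Finset.prod_const, Finset.card_univ]

end Coloring

/-- Encodes a set of at most Δ vertices by Δ entries with n + 1 possible values each, which gives
the factor (n+1)^(Δx) in the union bound. -/
theorem exists_option_enumeration {V : Type*} [DecidableEq V] {Δ : ℕ} (N : Finset V)
    (hN : N.card ≤ Δ) : ∃ f : Fin Δ → Option V, ∀ v, v ∈ N ↔ ∃ k, f k = some v := by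
  refine ⟨fun k => N.toList[(k : ℕ)]?, fun v => ?_⟩
  rw [← Finset.mem_toList, List.mem_iff_getElem?]
  constructor
  · rintro ⟨i, hi⟩
    obtain ⟨h, -⟩ := List.getElem?_eq_some_iff.mp hi
    rw [Finset.length_toList] at h
    exact ⟨⟨i, by omega⟩, hi⟩
  · rintro ⟨k, hk⟩
    exact ⟨k, hk⟩

/-- An edge colouring in which the graph of the colours in `S a` is expanding for every `a`. -/
theorem exists_expanding_coloring {n Q x y Δ σ : ℕ} (hQ : 0 < Q) (S : Fin Q → Finset (Fin Q))
    (hS : ∀ a, (S a).card = σ)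
    (hlt : (Q : ℝ) * ((n + 1) ^ (Δ * x) * n ^ y) * (1 - ((σ : ℝ) / Q) ^ Δ) ^ (x * y) < 1) :
    ∃ c : Sym2 (Fin n) → Fin Q, ∀ a, ∀ (N : Fin x → Finset (Fin n)) (Y : Finset (Fin n)),
      (∀ i j, i ≠ j → Disjoint (N i) (N j)) → (∀ i, (N i).card ≤ Δ) → Y.card = y →
      (∀ i, Disjoint (N i) Y) → ∃ i, ∃ b ∈ Y, ∀ u ∈ N i, c s(u, b) ∈ S a := by
  classical
  by_contra hcon
  push Not at hcon
  let nbr : (Fin x → Fin Δ → Option (Fin n)) → Fin x → Finset (Fin n) :=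
    fun f i => Finset.univ.filter fun v => ∃ k, f i k = some v
  have hnbr : ∀ f i, (nbr f i).card ≤ Δ := by
    intro f i
    have hsub : (nbr f i).map Function.Embedding.some ⊆ Finset.univ.image (f i) := by
      intro v hv
      obtain ⟨w, hw, rfl⟩ := Finset.mem_map.mp hv
      obtain ⟨k, hk⟩ := (Finset.mem_filter.mp hw).2
      exact Finset.mem_image.mpr ⟨k, Finset.mem_univ _, hk⟩
    have := (Finset.card_le_card hsub).trans Finset.card_image_le
    simpa using this
  -- Union bound over all possible violations. Including the colour makes all colours expand at
  -- once, so afterwards the rarest or the most frequent colour may be chosen and no concentration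
  -- estimate is needed.
  let Code := Fin Q × (Fin x → Fin Δ → Option (Fin n)) × (Fin y → Fin n)
  let bad : Code → Finset (Sym2 (Fin n) → Fin Q) := fun p => Finset.univ.filter fun c =>
    (∀ i j, i ≠ j → Disjoint (nbr p.2.1 i) (nbr p.2.1 j)) ∧ Function.Injective p.2.2 ∧
    (∀ i k, p.2.2 k ∉ nbr p.2.1 i) ∧ ∀ i k, ∃ u ∈ nbr p.2.1 i, c s(u, p.2.2 k) ∉ S p.1
  have hbad : ∀ p, ((bad p).card : ℝ) ≤
      (Q : ℝ) ^ Fintype.card (Sym2 (Fin n)) * (1 - ((σ : ℝ) / Q) ^ Δ) ^ (x * y) := by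
    intro p
    have hσ : ((σ : ℝ) / Q) ≤ 1 := by
      rw [div_le_one (by positivity), ← hS p.1]
      exact_mod_cast (Finset.card_le_univ _).trans (by simp)
    have hnn : 0 ≤ 1 - ((σ : ℝ) / Q) ^ Δ := by
      have := pow_le_one₀ (n := Δ) (by positivity) hσ
      linarith
    by_cases hvalid : (∀ i j, i ≠ j → Disjoint (nbr p.2.1 i) (nbr p.2.1 j)) ∧
        Function.Injective p.2.2 ∧ ∀ i k, p.2.2 k ∉ nbr p.2.1 i
    · obtain ⟨h1, h2, h3⟩ := hvalid
      -- For each pair (i, k) the edges from N i to the k-th vertex of Y; these xy edge sets are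
      -- disjoint since the N i are disjoint from each other and from Y.
      have := card_colorings_le hQ
        (fun j : Fin x × Fin y => (nbr p.2.1 j.1).image fun u => s(u, p.2.2 j.2))
        (fun i j hij => by
          rw [Finset.disjoint_left]
          intro e he he'
          obtain ⟨u, hu, rfl⟩ := Finset.mem_image.mp he
          obtain ⟨u', hu', heq⟩ := Finset.mem_image.mp he'
          rw [Sym2.eq_iff] at heq
          rcases heq with ⟨rfl, hk⟩ | ⟨rfl, hk⟩
          · have hi : i.1 = j.1 := by
              by_contra hne
              exact Finset.disjoint_left.mp (h1 _ _ hne) hu hu'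
            exact hij (Prod.ext hi (h2 hk).symm)
          · exact h3 _ _ hu')
        (S p.1) (t := Δ) (fun j => Finset.card_image_le.trans (hnbr _ _))
      rw [hS, Fintype.card_prod, Fintype.card_fin, Fintype.card_fin] at this
      refine le_trans ?_ this
      refine Nat.cast_le.mpr (Finset.card_le_card fun c hc => ?_)
      have hc := (Finset.mem_filter.mp hc).2.2.2.2
      refine Finset.mem_filter.mpr ⟨Finset.mem_univ _, fun j => ?_⟩
      obtain ⟨u, hu, hcu⟩ := hc j.1 j.2
      exact ⟨_, Finset.mem_image_of_mem _ hu, hcu⟩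
    · have : bad p = ∅ := by
        refine Finset.filter_eq_empty_iff.mpr fun c _ hc => hvalid ⟨hc.1, hc.2.1, hc.2.2.1⟩
      rw [this, Finset.card_empty, Nat.cast_zero]
      positivity
  have hcover : (Finset.univ : Finset (Sym2 (Fin n) → Fin Q)) ⊆ Finset.univ.biUnion bad := by
    intro c _
    obtain ⟨a, N, Y, h1, h2, h3, h4, h5⟩ := hcon c
    choose f hf using fun i => exists_option_enumeration (N i) (h2 i)
    have hN : ∀ i, nbr f i = N i := fun i => by
      ext v
      simp only [nbr, Finset.mem_filter, Finset.mem_univ, true_and]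
      exact (hf i v).symm
    let g : Fin y → Fin n := Y.orderEmbOfFin h3
    have hg : ∀ k, g k ∈ Y := fun k => Finset.orderEmbOfFin_mem Y h3 k
    refine Finset.mem_biUnion.mpr ⟨(a, f, g), Finset.mem_univ _,
      Finset.mem_filter.mpr ⟨Finset.mem_univ _, ?_, (Y.orderEmbOfFin h3).injective, ?_, ?_⟩⟩
    · intro i j hij
      rw [hN, hN]
      exact h1 i j hij
    · intro i k
      rw [hN]
      exact fun h => Finset.disjoint_left.mp (h4 i) h (hg k)
    · intro i k
      rw [hN]
      exact h5 i _ (hg k)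
  have hcount : ((Finset.univ : Finset (Sym2 (Fin n) → Fin Q)).card : ℝ) ≤
      ∑ p : Code, ((bad p).card : ℝ) := by
    exact_mod_cast (Finset.card_le_card hcover).trans Finset.card_biUnion_le
  have h2 := hcount.trans (Finset.sum_le_sum fun p _ => hbad p)
  have hcode : (Fintype.card Code : ℝ) = (Q : ℝ) * ((n + 1) ^ (Δ * x) * n ^ y) := by
    simp [Code, pow_mul]
  rw [Finset.sum_const, Finset.card_univ, Finset.card_univ, nsmul_eq_mul, hcode] at h2
  simp only [Fintype.card_fun, Fintype.card_fin, Nat.cast_pow] at h2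
  have h3 : 0 < (Q : ℝ) ^ Fintype.card (Sym2 (Fin n)) := by positivity
  nlinarith

theorem expansion_count_lt_one {n Q x y Δ σ : ℕ} (hQ : 0 < Q) (hσ : σ ≤ Q)
    (h : Real.log Q + (Δ * x + y) * Real.log (n + 1) < ((σ : ℝ) / Q) ^ Δ * (x * y)) :
    (Q : ℝ) * ((n + 1) ^ (Δ * x) * n ^ y) * (1 - ((σ : ℝ) / Q) ^ Δ) ^ (x * y) < 1 := by
  set t : ℝ := ((σ : ℝ) / Q) ^ Δ with ht
  have hQ' : (0 : ℝ) < Q := by exact_mod_cast hQ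
  have ht1 : t ≤ 1 := by
    refine pow_le_one₀ (by positivity) ?_
    rw [div_le_one hQ']
    exact_mod_cast hσ
  have h1 : (1 - t) ^ (x * y) ≤ Real.exp (-(t * (x * y))) := by
    calc (1 - t) ^ (x * y) ≤ Real.exp (-t) ^ (x * y) :=
          pow_le_pow_left₀ (by linarith) (Real.one_sub_le_exp_neg t) _
      _ = Real.exp (-(t * (x * y))) := by
          rw [← Real.exp_nat_mul]
          push_cast
          ring_nf
  have hn : (0 : ℝ) < n + 1 := by positivity
  have h2 : ((n : ℝ) + 1) ^ (Δ * x) * (n : ℝ) ^ y ≤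
      Real.exp ((Δ * x + y) * Real.log (n + 1)) := by
    calc ((n : ℝ) + 1) ^ (Δ * x) * (n : ℝ) ^ y ≤ (n + 1) ^ (Δ * x) * (n + 1) ^ y :=
          mul_le_mul_of_nonneg_left (pow_le_pow_left₀ (by positivity) (by linarith) _)
            (by positivity)
      _ = Real.exp (Real.log (n + 1)) ^ (Δ * x + y) := by rw [Real.exp_log hn, pow_add]
      _ = _ := by
          rw [← Real.exp_nat_mul]
          push_cast
          ring_nf
  calc _ ≤ Real.exp (Real.log Q) * Real.exp ((Δ * x + y) * Real.log (n + 1)) *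
        Real.exp (-(t * (x * y))) := by
        rw [Real.exp_log hQ']
        have : 0 ≤ (1 - t) ^ (x * y) := pow_nonneg (by linarith) _
        gcongr
    _ = Real.exp (Real.log Q + (Δ * x + y) * Real.log (n + 1) - t * (x * y)) := by
        rw [← Real.exp_add, ← Real.exp_add, sub_eq_add_neg]
    _ < 1 := by
        rw [Real.exp_lt_one_iff]
        linarith

/-! ### Hubs with random layers: edge counts and universality -/

section Layered

variable {n : ℕ}

/-- The graph in which `A` is joined to everything and, outside `A`, a pair is an edge if it lies
in the set assigned to the larger of the two levels. -/
def layeredGraph (A : Finset (Fin n)) (lev : Fin n → ℕ) (R : ℕ → Set (Sym2 (Fin n))) :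
    SimpleGraph (Fin n) where
  Adj u v := u ≠ v ∧ (u ∈ A ∨ v ∈ A ∨ s(u, v) ∈ R (max (lev u) (lev v)))
  symm := ⟨fun u v h => ⟨h.1.symm, by
    rw [Sym2.eq_swap, max_comm]
    tauto⟩⟩
  loopless := ⟨fun _ h => h.1 rfl⟩

/-- The vertices outside `A` on level `g`. -/
def levelSlots (A : Finset (Fin n)) (lev : Fin n → ℕ) (g : ℕ) : Finset (Fin n) :=
  Finset.univ.filter fun v => v ∉ A ∧ lev v = g

theorem mem_levelSlots {A : Finset (Fin n)} {lev : Fin n → ℕ} {g : ℕ} {v : Fin n} :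
    v ∈ levelSlots A lev g ↔ v ∉ A ∧ lev v = g := by
  simp [levelSlots]

theorem sum_card_levelSlots_le (A : Finset (Fin n)) (lev : Fin n → ℕ) (s : Finset ℕ) :
    ∑ g ∈ s, (levelSlots A lev g).card ≤ n - A.card := by
  rw [← Finset.card_biUnion]
  · refine (Finset.card_le_card (t := Finset.univ \ A) fun v hv => ?_).trans ?_
    · obtain ⟨g, -, hg⟩ := Finset.mem_biUnion.mp hv
      simp [(mem_levelSlots.mp hg).1]
    · rw [Finset.card_sdiff_of_subset (Finset.subset_univ _), Finset.card_univ, Fintype.card_fin]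
  · intro i _ j _ hij
    rw [Function.onFun, Finset.disjoint_left]
    intro v hi hj
    exact hij ((mem_levelSlots.mp hi).2.symm.trans (mem_levelSlots.mp hj).2)

/-- A pair joining level g to a level at most g is governed by R g alone, so expansion of R g is all
that group g needs. -/
theorem groupExpands_layeredGraph {A : Finset (Fin n)} {lev : Fin n → ℕ}
    {R : ℕ → Set (Sym2 (Fin n))} {x y g Δ : ℕ}
    (h : ∀ (N : Fin x → Finset (Fin n)) (Y : Finset (Fin n)),
      (∀ i j, i ≠ j → Disjoint (N i) (N j)) → (∀ i, (N i).card ≤ Δ) → Y.card = y →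
      (∀ i, Disjoint (N i) Y) → ∃ i, ∃ b ∈ Y, ∀ u ∈ N i, s(u, b) ∈ R g) :
    GroupExpands (layeredGraph A lev R) (levelSlots A lev) x y g Δ := by
  intro N Y h1 h2 h3 h4 h5 h6
  obtain ⟨i, b, hb, hu⟩ := h N Y h1 h2 h5 h6
  refine ⟨i, b, hb, fun u huN => ⟨?_, Or.inr (Or.inr ?_)⟩⟩
  · rintro rfl
    exact Finset.disjoint_left.mp (h6 i) huN hb
  · obtain ⟨j, hj, hju⟩ := Finset.mem_biUnion.mp (h3 i huN)
    have hj := Finset.mem_range.mp hj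
    rw [(mem_levelSlots.mp hju).2, (mem_levelSlots.mp (h4 hb)).2, max_eq_right (by omega)]
    exact hu u huN

theorem layeredGraph_adj_of_mem {A : Finset (Fin n)} {lev : Fin n → ℕ}
    {R : ℕ → Set (Sym2 (Fin n))} : ∀ a ∈ A, ∀ b, b ≠ a → (layeredGraph A lev R).Adj a b :=
  fun _ ha _ hb => ⟨hb.symm, Or.inl ha⟩

theorem exists_small_color {α : Type*} {Q : ℕ} (hQ : 0 < Q) (E : Finset α) (c : α → Fin Q) :
    ∃ a, ((E.filter fun e => c e = a).card : ℝ) ≤ E.card / Q := by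
  by_contra! h
  have hne : (Finset.univ : Finset (Fin Q)).Nonempty := ⟨⟨0, hQ⟩, Finset.mem_univ _⟩
  have h1 := Finset.sum_lt_sum_of_nonempty hne fun a _ => h a
  rw [Finset.sum_const, Finset.card_univ, Fintype.card_fin, nsmul_eq_mul,
    mul_div_cancel₀ _ (by positivity)] at h1
  have h2 := Finset.card_eq_sum_card_fiberwise (f := c) (s := E) (t := Finset.univ)
    fun _ _ => Finset.mem_univ _
  rw [h2] at h1
  push_cast at h1
  exact lt_irrefl _ h1

theorem exists_large_color {α : Type*} {Q : ℕ} (hQ : 0 < Q) (E : Finset α) (c : α → Fin Q) :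
    ∃ a, (E.card : ℝ) / Q ≤ ((E.filter fun e => c e = a).card : ℝ) := by
  by_contra! h
  have hne : (Finset.univ : Finset (Fin Q)).Nonempty := ⟨⟨0, hQ⟩, Finset.mem_univ _⟩
  have h1 := Finset.sum_lt_sum_of_nonempty hne fun a _ => h a
  rw [Finset.sum_const, Finset.card_univ, Fintype.card_fin, nsmul_eq_mul,
    mul_div_cancel₀ _ (by positivity)] at h1
  have h2 := Finset.card_eq_sum_card_fiberwise (f := c) (s := E) (t := Finset.univ)
    fun _ _ => Finset.mem_univ _
  rw [h2] at h1
  push_cast at h1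
  exact lt_irrefl _ h1

/-- The pairs of vertices outside `A` with maximal level `g`. -/
def levelPairs (A : Finset (Fin n)) (lev : Fin n → ℕ) (g : ℕ) : Finset (Sym2 (Fin n)) :=
  ((Finset.range (g + 1)).biUnion (levelSlots A lev) ×ˢ levelSlots A lev g).image
    fun p => s(p.1, p.2)

theorem mem_levelPairs {A : Finset (Fin n)} {lev : Fin n → ℕ} {u v : Fin n} (hu : u ∉ A)
    (hv : v ∉ A) (h : lev u ≤ lev v) : s(u, v) ∈ levelPairs A lev (lev v) := by
  refine Finset.mem_image.mpr ⟨(u, v), Finset.mem_product.mpr ⟨?_, ?_⟩, rfl⟩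
  · exact Finset.mem_biUnion.mpr ⟨lev u, Finset.mem_range.mpr (by omega),
      mem_levelSlots.mpr ⟨hu, rfl⟩⟩
  · exact mem_levelSlots.mpr ⟨hv, rfl⟩

theorem card_levelPairs_le (A : Finset (Fin n)) (lev : Fin n → ℕ) (g : ℕ) :
    (levelPairs A lev g).card ≤
      (∑ i ∈ Finset.range (g + 1), (levelSlots A lev i).card) * (levelSlots A lev g).card :=
  Finset.card_image_le.trans ((Finset.card_product _ _).trans_le
    (Nat.mul_le_mul_right _ Finset.card_biUnion_le))

open Classical in
theorem numEdges_layeredGraph_le {A : Finset (Fin n)} {lev : Fin n → ℕ}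
    {R : ℕ → Set (Sym2 (Fin n))} {G : ℕ} (hG : ∀ v, v ∉ A → lev v < G) :
    numEdges (layeredGraph A lev R) ≤ A.card * n + ∑ g ∈ Finset.range G,
      ((levelPairs A lev g).filter (· ∈ R g)).card := by
  let T : Finset (Sym2 (Fin n)) :=
    (A ×ˢ (Finset.univ : Finset (Fin n))).image fun p => s(p.1, p.2)
  let T' : Finset (Sym2 (Fin n)) :=
    (Finset.range G).biUnion fun g => (levelPairs A lev g).filter (· ∈ R g)
  have hT : T.card ≤ A.card * n := by
    refine Finset.card_image_le.trans ?_
    rw [Finset.card_product, Finset.card_univ, Fintype.card_fin]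
  have hT' : T'.card ≤ ∑ g ∈ Finset.range G, ((levelPairs A lev g).filter (· ∈ R g)).card :=
    Finset.card_biUnion_le
  have main : ∀ u v, (layeredGraph A lev R).Adj u v → lev u ≤ lev v → s(u, v) ∈ T ∪ T' := by
    rintro u v ⟨huv, hadj⟩ hle
    by_cases hu : u ∈ A
    · exact Finset.mem_union_left _ (Finset.mem_image.mpr ⟨(u, v), by simp [hu], rfl⟩)
    by_cases hv : v ∈ A
    · exact Finset.mem_union_left _ (Finset.mem_image.mpr ⟨(v, u), by simp [hv], Sym2.eq_swap⟩)
    have h := (hadj.resolve_left hu).resolve_left hv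
    rw [max_eq_right hle] at h
    exact Finset.mem_union_right _ (Finset.mem_biUnion.mpr
      ⟨lev v, Finset.mem_range.mpr (hG v hv), Finset.mem_filter.mpr ⟨mem_levelPairs hu hv hle, h⟩⟩)
  have hsub : (layeredGraph A lev R).edgeSet ⊆ ((T ∪ T' : Finset (Sym2 (Fin n))) : Set _) := by
    intro e he
    induction e with
    | _ u v =>
      rw [mem_edgeSet] at he
      rw [Finset.mem_coe]
      rcases le_total (lev u) (lev v) with h | h
      · exact main u v he h
      · rw [Sym2.eq_swap]
        exact main v u he.symm h
  have h1 := Set.ncard_le_ncard hsub (Finset.finite_toSet _)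
  rw [Set.ncard_coe_finset] at h1
  exact h1.trans ((Finset.card_union_le _ _).trans (Nat.add_le_add hT hT'))

/-- A universal graph with hubs `A` and random layers of densities `1 / Q g`. -/
theorem univMin_le_of_levels {m : ℕ} {A : Finset (Fin n)} {lev : Fin n → ℕ}
    {x y P G τ d : ℕ} {Δ Q : ℕ → ℕ} (hG : ∀ v, v ∉ A → lev v < G) (hQ : ∀ g, 0 < Q g)
    (hd : 4 * m ≤ d * n) (hw : 2 * (G * y * (d + 1)) ≤ n)
    (hsum : τ + ∑ g ∈ Finset.range G, ((levelSlots A lev g).card + x * (P * P + 1)) +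
      G * y * (d + 1) ≤ n)
    (hP : 2 * m < (P + 1) * τ)
    (hΔ : ∀ g < G, 2 * m <
      (Δ g + 1) * (τ + ∑ i ∈ Finset.range g, (levelSlots A lev i).card))
    (hlog : ∀ g < G, Real.log (Q g) + (Δ g * x + y) * Real.log (n + 1) <
      (1 / (Q g : ℝ)) ^ Δ g * (x * y)) :
    (univMin n m : ℝ) ≤ A.card * n + ∑ g ∈ Finset.range G,
      ((∑ i ∈ Finset.range (g + 1), (levelSlots A lev i).card : ℕ) : ℝ) *
        (levelSlots A lev g).card / Q g := by
  classical
  have hR : ∀ g, ∃ R : Set (Sym2 (Fin n)), g < G →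
      (∀ (N : Fin x → Finset (Fin n)) (Y : Finset (Fin n)),
        (∀ i j, i ≠ j → Disjoint (N i) (N j)) → (∀ i, (N i).card ≤ Δ g) → Y.card = y →
        (∀ i, Disjoint (N i) Y) → ∃ i, ∃ b ∈ Y, ∀ u ∈ N i, s(u, b) ∈ R) ∧
      ((((levelPairs A lev g).filter (· ∈ R)).card : ℕ) : ℝ) ≤
        ((∑ i ∈ Finset.range (g + 1), (levelSlots A lev i).card : ℕ) : ℝ) *
        (levelSlots A lev g).card / Q g := by
    intro g
    by_cases hg : g < G
    swap
    · exact ⟨∅, fun h => absurd h hg⟩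
    -- Single colours serve as layers of density 1/Q; the rarest colour on the relevant pairs is
    -- kept.
    obtain ⟨c, hc⟩ := exists_expanding_coloring (n := n) (x := x) (y := y) (Δ := Δ g) (hQ g)
      (fun a => {a}) (σ := 1) (by simp)
      (expansion_count_lt_one (hQ g) (hQ g) (by simpa using hlog g hg))
    obtain ⟨a, ha⟩ := exists_small_color (hQ g) (levelPairs A lev g) c
    refine ⟨{e | c e = a}, fun _ => ⟨fun N Y h1 h2 h3 h4 => ?_, ?_⟩⟩
    · obtain ⟨i, b, hb, h⟩ := hc a N Y h1 h2 h3 h4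
      exact ⟨i, b, hb, fun u hu => by simpa using h u hu⟩
    · refine le_trans (le_of_eq ?_) (ha.trans ?_)
      · congr 2
        ext e
        simp
      · gcongr
        exact_mod_cast card_levelPairs_le A lev g
  choose R hR using hR
  have huniv : IsUniversal n m (layeredGraph A lev R) :=
    isUniversal_of_groups (B := levelSlots A lev) layeredGraph_adj_of_mem (fun v => by
      by_cases hv : v ∈ A
      · exact Or.inl hv
      · exact Or.inr ⟨lev v, hG v hv, mem_levelSlots.mpr ⟨hv, rfl⟩⟩) hd hw hsum hP hΔ
      fun g hg => groupExpands_layeredGraph (hR g hg).1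
  have h1 := (univMin_le huniv).trans (numEdges_layeredGraph_le (R := R) hG)
  refine le_trans (Nat.cast_le.mpr h1) ?_
  push_cast
  refine add_le_add le_rfl (Finset.sum_le_sum fun g hg => ?_)
  have := (hR g (Finset.mem_range.mp hg)).2
  push_cast at this
  exact this

/-- The complement of a random graph of density `1 / Q` on the vertices outside `A`. -/
theorem le_unavoidMax_of_hubs {m e : ℕ} (he : e + m = n.choose 2) {A : Finset (Fin n)}
    {x y P Q τ d : ℕ} (hQ : 2 ≤ Q)
    (hd : 4 * m ≤ d * n) (hw : 2 * (y * (d + 1)) ≤ n)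
    (hsum : τ + ((n - A.card) + x * (P * P + 1)) + y * (d + 1) ≤ n)
    (hP : 2 * m < (P + 1) * τ)
    (hlog : Real.log Q + (P * x + y) * Real.log (n + 1) <
      (1 - 1 / (Q : ℝ)) ^ P * (x * y)) :
    ((n - A.card).choose 2 : ℝ) / Q ≤ unavoidMax n e := by
  classical
  have hQ0 : 0 < Q := by omega
  have hQ' : (0 : ℝ) < Q := by exact_mod_cast hQ0
  -- Here the layer consists of all colours but one, and the most frequent colour outside A is
  -- omitted: it supplies the non-edges of U.
  obtain ⟨c, hc⟩ := exists_expanding_coloring (n := n) (x := x) (y := y) (Δ := P) hQ0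
    (fun a => {a}ᶜ) (σ := Q - 1) (fun a => by rw [Finset.card_compl]; simp)
    (expansion_count_lt_one hQ0 (by omega) (by
      rwa [Nat.cast_sub (by omega), sub_div, div_self hQ'.ne', Nat.cast_one]))
  obtain ⟨a, ha⟩ := exists_large_color hQ0
    ((Finset.univ \ A).offDiag.image fun p => s(p.1, p.2)) c
  let U := layeredGraph A (fun _ => 0) fun _ => {e | c e ≠ a}
  have hcardA : (Finset.univ \ A).card = n - A.card := by
    rw [Finset.card_sdiff_of_subset (Finset.subset_univ _), Finset.card_univ, Fintype.card_fin]
  have hB : (levelSlots A (fun _ => 0) 0).card = n - A.card := by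
    rw [← hcardA]
    congr 1
    ext v
    simp [mem_levelSlots]
  have huniv : IsUniversal n m U :=
    isUniversal_of_groups (B := levelSlots A fun _ => 0) (G := 1) (Δ := fun _ => P) (τ := τ)
      (x := x) (y := y) (P := P) (d := d)
      layeredGraph_adj_of_mem (fun v => by
        by_cases hv : v ∈ A
        · exact Or.inl hv
        · exact Or.inr ⟨0, one_pos, mem_levelSlots.mpr ⟨hv, rfl⟩⟩) hd (by simpa using hw)
      (by simpa [hB] using hsum) hP (fun g hg => by
        obtain rfl : g = 0 := by omega
        simpa using hP)
      fun g hg => groupExpands_layeredGraph fun N Y h1 h2 h3 h4 => by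
        obtain ⟨i, b, hb, h⟩ := hc a N Y h1 h2 h3 h4
        exact ⟨i, b, hb, fun u hu => by simpa using h u hu⟩
  have h1 := univMin_le huniv
  have h2 := univMin_add_unavoidMax he
  have h3 := numEdges_add_compl U
  have hcol : (((Finset.univ \ A).offDiag.image fun p => s(p.1, p.2)).filter
      fun e => c e = a).card ≤ numEdges Uᶜ := by
    rw [numEdges_eq_card]
    refine Finset.card_le_card fun e he => ?_
    obtain ⟨he1, he2⟩ := Finset.mem_filter.mp he
    obtain ⟨⟨u, v⟩, huv, rfl⟩ := Finset.mem_image.mp he1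
    simp only [Finset.mem_offDiag, Finset.mem_sdiff, Finset.mem_univ, true_and] at huv
    rw [mem_edgeFinset, mem_edgeSet, compl_adj]
    refine ⟨huv.2.2, ?_⟩
    rintro ⟨-, h | h | h⟩
    · exact huv.1 h
    · exact huv.2.1 h
    · exact h he2
  have h4 : (((Finset.univ \ A).offDiag.image fun p : Fin n × Fin n => s(p.1, p.2)).card) =
      (n - A.card).choose 2 := by
    rw [← hcardA]
    exact Sym2.card_image_offDiag _
  rw [h4] at ha
  exact ha.trans (Nat.cast_le.mpr (by omega))

end Layered

/-! ### Dyadic layers of density 8^(-g) -/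

section Dyadic

/-- The dyadic level of a vertex in blocks of lengths `K, 2 K, 4 K, …` starting at `h`. -/
def dyadicLevel {n : ℕ} (h K : ℕ) (v : Fin n) : ℕ := Nat.log 2 ((v - h) / K + 1)

def initialVertices (n h : ℕ) : Finset (Fin n) := Finset.univ.filter fun v => (v : ℕ) < h

theorem card_initialVertices {n h : ℕ} (hh : h ≤ n) : (initialVertices n h).card = h := by
  rw [← Finset.card_map Fin.valEmbedding]
  have : (initialVertices n h).map Fin.valEmbedding = Finset.range h := by
    ext k
    simp only [initialVertices, Finset.mem_map, Finset.mem_filter, Finset.mem_univ, true_and,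
      Fin.valEmbedding_apply, Finset.mem_range]
    constructor
    · rintro ⟨i, hi, rfl⟩
      exact hi
    · intro hk
      exact ⟨⟨k, by omega⟩, hk, rfl⟩
  rw [this, Finset.card_range]

theorem mem_initialVertices {n h : ℕ} {v : Fin n} : v ∈ initialVertices n h ↔ (v : ℕ) < h := by
  simp [initialVertices]

theorem dyadicLevel_lt_iff {n h K g : ℕ} (hK : 0 < K) {v : Fin n} :
    dyadicLevel h K v < g ↔ (v : ℕ) - h < (2 ^ g - 1) * K := by
  have h0 : ((v : ℕ) - h) / K + 1 ≠ 0 := Nat.succ_ne_zero _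
  rw [dyadicLevel, Nat.log_lt_iff_lt_pow one_lt_two h0, ← Nat.lt_sub_iff_add_lt,
    Nat.div_lt_iff_lt_mul hK]

theorem card_levelSlots_dyadic_le {n h K g : ℕ} (hK : 0 < K) :
    (levelSlots (initialVertices n h) (dyadicLevel h K) g).card ≤ 2 ^ g * K := by
  have h1 : (Finset.Ico ((2 ^ g - 1) * K) ((2 ^ (g + 1) - 1) * K)).card = 2 ^ g * K := by
    rw [Nat.card_Ico, ← Nat.sub_mul]
    congr 1
    have := Nat.one_le_two_pow (n := g)
    rw [pow_succ]
    omega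
  rw [← h1]
  refine Finset.card_le_card_of_injOn (fun v => (v : ℕ) - h) (fun v hv => ?_)
    (fun u hu v hv huv => ?_)
  · have hv := (mem_levelSlots.mp hv).2
    have h2 : dyadicLevel h K v < g + 1 := by omega
    have h3 : ¬ dyadicLevel h K v < g := by omega
    rw [dyadicLevel_lt_iff hK] at h2 h3
    rw [Finset.mem_coe, Finset.mem_Ico]
    exact ⟨not_lt.mp h3, h2⟩
  · have hu := (mem_levelSlots.mp hu).1
    have hv := (mem_levelSlots.mp hv).1
    rw [mem_initialVertices] at hu hv
    simp only at huv
    exact Fin.ext (by omega)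

theorem le_sum_card_levelSlots_dyadic {n h K g : ℕ} (hK : 0 < K) (hg : (2 ^ g - 1) * K + h ≤ n) :
    (2 ^ g - 1) * K ≤ ∑ i ∈ Finset.range g,
      (levelSlots (initialVertices n h) (dyadicLevel h K) i).card := by
  refine le_trans ?_ Finset.card_biUnion_le
  rw [← Fintype.card_fin ((2 ^ g - 1) * K), ← Finset.card_univ]
  refine Finset.card_le_card_of_injOn (fun j => (⟨h + j, by omega⟩ : Fin n)) (fun j _ => ?_)
    (fun i _ j _ hij => ?_)
  · rw [Finset.mem_coe, Finset.mem_biUnion]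
    refine ⟨dyadicLevel h K ⟨h + j, by omega⟩, ?_, mem_levelSlots.mpr ⟨?_, rfl⟩⟩
    · rw [Finset.mem_range, dyadicLevel_lt_iff hK]
      simp
    · rw [mem_initialVertices]
      simp
  · simp only [Fin.mk.injEq] at hij
    exact Fin.ext (by omega)

/-- Layer g has at most 2^g K slots and sees at most 2^(g+1) K, so at density 8^(-g) it costs at
most 2K² / 2^g edges, a geometric series with sum at most 4K². The hubs cost at most hn. -/
theorem univMin_le_of_dyadic {n m h K τ s P d G : ℕ} (hK : 0 < K) (hh : h ≤ n) (hτ : 0 < τ)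
    (hG : ∀ g < G, (2 ^ g - 1) * K + h ≤ n) (hG' : n ≤ h + (2 ^ G - 1) * K)
    (hd : 4 * m ≤ d * n) (hw : 2 * (G * s * (d + 1)) ≤ n)
    (hsum : τ + G * (s * (P * P + 1)) + G * s * (d + 1) ≤ h)
    (hP : 2 * m < (P + 1) * τ)
    (hlog : ∀ g < G, Real.log ((8 ^ g : ℕ) : ℝ) +
      (((2 * m / (τ + (2 ^ g - 1) * K) : ℕ) : ℝ) * s + s) * Real.log (n + 1) <
      (1 / ((8 ^ g : ℕ) : ℝ)) ^ (2 * m / (τ + (2 ^ g - 1) * K)) * (s * s)) :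
    (univMin n m : ℝ) ≤ h * n + 4 * (K : ℝ) ^ 2 := by
  have hcard := card_initialVertices hh
  have hs := sum_card_levelSlots_le (initialVertices n h) (dyadicLevel h K) (Finset.range G)
  rw [hcard] at hs
  have main := univMin_le_of_levels (n := n) (m := m) (A := initialVertices n h)
    (lev := dyadicLevel h K) (x := s) (y := s) (P := P) (G := G) (τ := τ) (d := d)
    (Δ := fun g => 2 * m / (τ + (2 ^ g - 1) * K)) (Q := fun g => 8 ^ g)
    (fun v hv => by
      rw [dyadicLevel_lt_iff hK]
      rw [mem_initialVertices] at hv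
      omega)
    (fun g => by positivity) hd hw (by
      rw [Finset.sum_add_distrib, Finset.sum_const, Finset.card_range, smul_eq_mul]
      omega) hP (fun g hg => by
      have h1 := le_sum_card_levelSlots_dyadic hK (hG g hg)
      refine lt_of_lt_of_le ?_ (Nat.mul_le_mul_left _ (Nat.add_le_add_left h1 τ))
      exact (Nat.lt_mul_div_succ _ (by omega)).trans_eq (mul_comm _ _)) hlog
  rw [hcard] at main
  refine main.trans (add_le_add le_rfl ?_)
  have hterm : ∀ g ∈ Finset.range G, ((∑ i ∈ Finset.range (g + 1),
      (levelSlots (initialVertices n h) (dyadicLevel h K) i).card : ℕ) : ℝ) *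
        (levelSlots (initialVertices n h) (dyadicLevel h K) g).card / ((8 ^ g : ℕ) : ℝ) ≤
      2 * (K : ℝ) ^ 2 * (1 / 2) ^ g := by
    intro g _
    have h1 : ∑ i ∈ Finset.range (g + 1),
        (levelSlots (initialVertices n h) (dyadicLevel h K) i).card ≤ 2 ^ (g + 1) * K := by
      calc _ ≤ ∑ i ∈ Finset.range (g + 1), 2 ^ i * K :=
            Finset.sum_le_sum fun i _ => card_levelSlots_dyadic_le hK
        _ ≤ 2 ^ (g + 1) * K := by
            rw [← Finset.sum_mul, Nat.geomSum_eq le_rfl]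
            exact Nat.mul_le_mul_right _ (by simp)
    have h2 := card_levelSlots_dyadic_le (n := n) (h := h) (g := g) hK
    have h1' : ((∑ i ∈ Finset.range (g + 1),
      (levelSlots (initialVertices n h) (dyadicLevel h K) i).card : ℕ) : ℝ) ≤
        2 ^ (g + 1) * K := by exact_mod_cast h1
    have h2' : ((levelSlots (initialVertices n h) (dyadicLevel h K) g).card : ℝ) ≤
        2 ^ g * K := by exact_mod_cast h2
    have h8 : ((8 ^ g : ℕ) : ℝ) = 2 ^ g * 2 ^ g * 2 ^ g := by
      push_cast
      rw [← mul_pow, ← mul_pow]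
      norm_num
    rw [h8, div_le_iff₀ (by positivity)]
    calc _ ≤ (2 ^ (g + 1) * (K : ℝ)) * (2 ^ g * K) := by gcongr
      _ = 2 * (K : ℝ) ^ 2 * ((1 / 2) ^ g * 2 ^ g) * (2 ^ g * 2 ^ g) := by
          rw [← mul_pow]
          norm_num
          ring
      _ = _ := by ring
  refine (Finset.sum_le_sum hterm).trans ?_
  rw [← Finset.mul_sum]
  have hgeom : ∑ g ∈ Finset.range G, ((1 : ℝ) / 2) ^ g ≤ 2 := by
    have h1 := Summable.sum_le_tsum (Finset.range G) (fun i _ => by positivity)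
      summable_geometric_two
    rwa [tsum_geometric_two] at h1
  nlinarith [sq_nonneg (K : ℝ)]

end Dyadic

/-! ### Choice of parameters for sparse universal graphs -/

/-- The power 14 gives √m ≥ 300 (log m)^7, which absorbs the surpluses and wildcards into the hubs,
and m^(1/4) ≥ 10 (log m)³, which gives expansion. -/
theorem eventually_log_pow_le :
    ∃ m₀ : ℕ, ∀ m : ℕ, m₀ ≤ m → 10 ≤ Real.log m ∧ 10 ^ 5 * Real.log m ^ 14 ≤ m := by
  have h1 : ∀ᶠ x : ℝ in Filter.atTop, 10 ≤ Real.log x :=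
    Real.tendsto_log_atTop.eventually_ge_atTop 10
  have h2 := (Real.isLittleO_pow_log_id_atTop (n := 14)).bound
    (show (0 : ℝ) < 1 / 10 ^ 5 by positivity)
  obtain ⟨m₀, hm₀⟩ := Filter.eventually_atTop.mp
    ((h1.and h2).and (Filter.eventually_ge_atTop 1))
  refine ⟨⌈m₀⌉₊, fun m hm => ?_⟩
  obtain ⟨⟨ha, hb⟩, hc⟩ := hm₀ m (Nat.ceil_le.mp hm)
  refine ⟨ha, ?_⟩
  rw [Real.norm_of_nonneg (by positivity), id, Real.norm_of_nonneg (by positivity)] at hb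
  linarith

theorem inv_pow_dyadic_ge {g Δ : ℕ} {l : ℝ} (h : (g : ℝ) * Δ ≤ l / 10) :
    Real.exp (-(l / 4)) ≤ (1 / ((8 ^ g : ℕ) : ℝ)) ^ Δ := by
  have h8 : Real.log 8 ≤ 2.1 := by
    have := Real.log_two_lt_d9
    rw [show (8 : ℝ) = 2 ^ 3 by norm_num, Real.log_pow]
    norm_num
    linarith
  have h80 : 0 ≤ Real.log 8 := Real.log_nonneg (by norm_num)
  have hgd : (0 : ℝ) ≤ g * Δ := by positivity
  have : (1 / ((8 ^ g : ℕ) : ℝ)) ^ Δ = Real.exp (-(g * Δ * Real.log 8)) := by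
    rw [Real.exp_neg, ← Nat.cast_mul, Real.exp_nat_mul,
      Real.exp_log (show (0 : ℝ) < 8 by norm_num)]
    push_cast
    rw [one_div, inv_pow, ← pow_mul]
  rw [this]
  apply Real.exp_le_exp.mpr
  nlinarith

/-- With l = log m and s about √m, the left side is O(s l³), while the right side is at least s²
e^(-l/4) ≥ s e^(l/4). -/
theorem dyadic_expansion {l N : ℝ} {g Δ s : ℕ} (hl : 10 ≤ l)
    (hexp : 10 ^ 5 * l ^ 14 ≤ Real.exp l) (hs : Real.exp (l / 2) ≤ s) (hg : (g : ℝ) + 1 ≤ l)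
    (hΔ : (Δ : ℝ) ≤ 4 * l ^ 2) (hgΔ : (g : ℝ) * Δ ≤ l / 10) (hN : 0 ≤ N) (hN' : N ≤ 2 * l) :
    Real.log ((8 ^ g : ℕ) : ℝ) + ((Δ : ℝ) * s + s) * N <
      (1 / ((8 ^ g : ℕ) : ℝ)) ^ Δ * (s * s) := by
  have hl0 : 0 < l := by linarith
  have ht := inv_pow_dyadic_ge hgΔ
  have hlog8 : Real.log ((8 ^ g : ℕ) : ℝ) ≤ 3 * l := by
    push_cast
    rw [Real.log_pow]
    have h8 : Real.log 8 ≤ 3 := by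
      have := Real.log_two_lt_d9
      rw [show (8 : ℝ) = 2 ^ 3 by norm_num, Real.log_pow]
      norm_num
      linarith
    have h80 : 0 ≤ Real.log 8 := Real.log_nonneg (by norm_num)
    nlinarith
  have hs1 : (1 : ℝ) ≤ s := (Real.one_le_exp (by positivity)).trans hs
  have he4 : 10 * l ^ 3 ≤ Real.exp (l / 4) := by
    have h1 : Real.exp (l / 4) ^ 4 = Real.exp l := by
      rw [← Real.exp_nat_mul]
      congr 1
      push_cast
      ring
    refine le_of_pow_le_pow_left₀ (n := 4) (by norm_num) (Real.exp_pos _).le ?_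
    rw [h1]
    have h2 : (10 * l ^ 3) ^ 4 = 10 ^ 4 * l ^ 12 := by ring
    have h3 : l ^ 14 = l ^ 2 * l ^ 12 := by ring
    have h4 : (0 : ℝ) < l ^ 12 := by positivity
    have h5 : 1 ≤ l ^ 2 := one_le_pow₀ (by linarith)
    nlinarith
  have hrl : Real.exp (l / 2) = Real.exp (l / 4) * Real.exp (l / 4) := by
    rw [← Real.exp_add]
    ring_nf
  calc Real.log ((8 ^ g : ℕ) : ℝ) + ((Δ : ℝ) * s + s) * N
      ≤ 3 * l + (4 * l ^ 2 * s + s) * (2 * l) := by gcongr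
    _ ≤ s * (9 * l ^ 3) := by
        have h3 : l ^ 3 = l * (l * l) := by ring
        have h4 : 5 * l ≤ l ^ 3 := by
          have := mul_pos hl0 hl0
          nlinarith
        nlinarith
    _ < s * (10 * l ^ 3) := by
        have : 0 < l ^ 3 := by positivity
        nlinarith
    _ ≤ s * Real.exp (l / 4) := by gcongr
    _ = Real.exp (-(l / 4)) * (s * Real.exp (l / 2)) := by
        rw [hrl, Real.exp_neg]
        field_simp
    _ ≤ (1 / ((8 ^ g : ℕ) : ℝ)) ^ Δ * (s * s) :=
        mul_le_mul ht (mul_le_mul_of_nonneg_left hs (by positivity)) (by positivity)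
          (by positivity)

set_option maxHeartbeats 1000000 in
theorem exists_univMin_le_of_le_two_mul :
    ∃ m₀ : ℕ, ∀ n m : ℕ, m₀ ≤ m → n ≤ 2 * m →
      (univMin n m : ℝ) ≤ 10 ^ 4 * ((m : ℝ) ^ 2 / Real.log m ^ 2) := by
  obtain ⟨m₀, hm₀⟩ := eventually_log_pow_le
  refine ⟨m₀ + 2, fun n m hm hn => ?_⟩
  obtain ⟨hl, hlm⟩ := hm₀ m (by omega)
  have hmpos : (0 : ℝ) < m := by
    have : 0 < m := by omega
    exact_mod_cast this
  set l := Real.log m with hldef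
  have hexp : Real.exp l = m := Real.exp_log hmpos
  have hl0 : 0 < l := by linarith
  rw [← div_pow]
  set k := (m : ℝ) / l with hk
  have hkl : k * l = m := div_mul_cancel₀ _ hl0.ne'
  have hk0 : 0 < k := by positivity
  -- For such n the complete graph is good enough; this case determines the constant 10^4.
  by_cases htriv : (n : ℝ) < 100 * k
  · have h1 : (univMin n m : ℝ) ≤ (n : ℝ) ^ 2 := by
      exact_mod_cast (univMin_le_choose n m).trans (Nat.choose_le_pow n 2)
    have h2 : (n : ℝ) ^ 2 ≤ (100 * k) ^ 2 := pow_le_pow_left₀ (by positivity) htriv.le 2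
    linarith [mul_pow 100 k 2]
  push Not at htriv
  have hn' : (n : ℝ) ≤ 2 * m := by exact_mod_cast hn
  have hn0 : (0 : ℝ) < n := by linarith
  have hp : ∀ j : ℕ, (1 : ℝ) ≤ l ^ j := fun j => one_le_pow₀ (by linarith)
  have hk_ge : 100 ≤ k := by
    rw [hk, le_div_iff₀ hl0]
    have h1 : l ^ 14 = l * l ^ 13 := by ring
    linarith [mul_le_mul_of_nonneg_left (hp 13) hl0.le]
  have hmk : (m : ℝ) ≤ k ^ 2 := by
    have h1 : l ≤ k := by
      rw [hk, le_div_iff₀ hl0]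
      have h1 : l ^ 14 = l * l * l ^ 12 := by ring
      linarith [mul_le_mul_of_nonneg_left (hp 12) (mul_pos hl0 hl0).le, mul_pos hl0 hl0]
    rw [← hkl, sq]
    exact mul_le_mul_of_nonneg_left h1 hk0.le
  set r := Real.sqrt m with hr
  have hrr : r * r = m := Real.mul_self_sqrt hmpos.le
  have hr0 : 0 < r := Real.sqrt_pos.mpr hmpos
  have hr_ge : 300 * l ^ 7 ≤ r := by
    apply Real.le_sqrt_of_sq_le
    have : (300 * l ^ 7) ^ 2 = 90000 * l ^ 14 := by ring
    linarith [hp 14]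
  have hr1 : 1 ≤ r := by linarith [hp 7]
  set s := Nat.sqrt m + 1 with hs
  have hs_ge : r ≤ s := by
    rw [hr, Real.sqrt_le_left (by positivity)]
    have := (Nat.lt_succ_sqrt' m).le
    exact_mod_cast this
  have hs_le : (s : ℝ) ≤ 2 * r := by
    have : ((Nat.sqrt m : ℕ) : ℝ) ≤ r := Real.nat_sqrt_le_real_sqrt
    rw [hs]
    push_cast
    linarith
  -- The 4τ hubs then cost about 4k² edges, the target order, while the remaining degrees are at
  -- most 4 (log m)².
  set τ := ⌈k ^ 2 / n⌉₊ with hτ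
  have hτ_ge : k ^ 2 / n ≤ τ := Nat.le_ceil _
  have hτ0 : 0 < τ := Nat.ceil_pos.mpr (by positivity)
  have hτ0' : (0 : ℝ) < τ := by exact_mod_cast hτ0
  have hτ_lt : (τ : ℝ) ≤ k ^ 2 / n + 1 := (Nat.ceil_lt_add_one (by positivity)).le
  have hτ_m : (m : ℝ) ≤ 2 * l ^ 2 * τ := by
    have h1 : (m : ℝ) / (2 * l ^ 2) ≤ k ^ 2 / n := by
      rw [div_le_div_iff₀ (by positivity) hn0, ← hkl]
      have : (k * l) * n ≤ (k * l) * (2 * (k * l)) := by rw [hkl]; gcongr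
      linarith [this, show (k * l) * (2 * (k * l)) = k ^ 2 * (2 * l ^ 2) by ring]
    have := h1.trans hτ_ge
    rw [div_le_iff₀ (by positivity)] at this
    linarith
  have hτ_n : (τ : ℝ) ≤ n / 10 ^ 4 + 1 := by
    have : k ^ 2 / n ≤ n / 10 ^ 4 := by
      rw [div_le_div_iff₀ hn0 (by positivity)]
      linarith [pow_le_pow_left₀ (by positivity) htriv 2, mul_pow 100 k 2, sq (n : ℝ)]
    linarith
  -- Since g ≤ 2^g - 1, the degree bound Δ of group g satisfies gΔ ≤ 2m/K ≤ l/10, as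
  -- `inv_pow_dyadic_ge` requires.
  set K := ⌈20 * k⌉₊ with hK
  have hK_ge : 20 * k ≤ K := Nat.le_ceil _
  have hK_le : (K : ℝ) ≤ 21 * k := by
    have := (Nat.ceil_lt_add_one (show (0 : ℝ) ≤ 20 * k by positivity)).le
    linarith
  have hK0 : 0 < K := Nat.ceil_pos.mpr (by positivity)
  have hK0' : (0 : ℝ) < K := by exact_mod_cast hK0
  set P := 2 * m / τ with hP
  have hP_le : (P : ℝ) ≤ 4 * l ^ 2 := by
    refine Nat.cast_div_le.trans ?_
    rw [div_le_iff₀ hτ0']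
    push_cast
    linarith
  set d := 4 * m / n + 1 with hd
  have hnpos : 0 < n := by exact_mod_cast hn0
  have hd_le : (d : ℝ) ≤ l := by
    have h1 : ((4 * m / n : ℕ) : ℝ) ≤ ((4 * m : ℕ) : ℝ) / n := Nat.cast_div_le
    have h2 : ((4 * m : ℕ) : ℝ) / n ≤ l / 25 := by
      rw [div_le_iff₀ hn0]
      push_cast
      linarith [mul_le_mul_of_nonneg_left htriv hl0.le]
    rw [hd]
    push_cast
    linarith
  have hex : ∃ G : ℕ, n ≤ 4 * τ + (2 ^ G - 1) * K := by
    refine ⟨n, ?_⟩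
    have h1 : n ≤ 2 ^ n - 1 := by
      have := Nat.lt_two_pow_self (n := n)
      omega
    exact h1.trans ((Nat.le_mul_of_pos_right _ hK0).trans (Nat.le_add_left _ _))
  -- The least number of layers that covers all vertices; minimality gives the bounds on g.
  obtain ⟨G, hG', hG⟩ : ∃ G, n ≤ 4 * τ + (2 ^ G - 1) * K ∧
      ∀ g < G, (2 ^ g - 1) * K + 4 * τ ≤ n := by
    classical
    refine ⟨Nat.find hex, Nat.find_spec hex, fun g hg => ?_⟩
    have := Nat.find_min hex hg
    omega
  have h2g : ∀ g < G, ((2 : ℝ) ^ g - 1) * K ≤ n := fun g hg => by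
    have h1 : (2 ^ g - 1) * K ≤ n := (Nat.le_add_right _ _).trans (hG g hg)
    have h2 : (((2 ^ g - 1) * K : ℕ) : ℝ) ≤ n := by exact_mod_cast h1
    rw [Nat.cast_mul, Nat.cast_sub Nat.one_le_two_pow] at h2
    exact_mod_cast h2
  have hgl : ∀ g < G, ((g : ℝ) + 1) ≤ l := fun g hg => by
    have h1 := h2g g hg
    have h2 : (g : ℝ) + 1 ≤ 2 ^ g := by exact_mod_cast Nat.lt_two_pow_self (n := g)
    have h3 : ((2 : ℝ) ^ g - 1) * (20 * k) ≤ 2 * (k * l) := by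
      rw [hkl]
      refine le_trans (mul_le_mul_of_nonneg_left hK_ge ?_) (h1.trans hn')
      have : (0 : ℝ) ≤ g := by positivity
      linarith
    have h4 : ((2 : ℝ) ^ g - 1) * 10 ≤ l := by
      refine le_of_mul_le_mul_left ?_ hk0
      linarith
    linarith
  have hGl : (G : ℝ) ≤ l := by
    rcases Nat.eq_zero_or_pos G with h | h
    · rw [h, Nat.cast_zero]
      linarith
    · have := hgl (G - 1) (by omega)
      rwa [Nat.cast_sub h, Nat.cast_one, sub_add_cancel] at this
  have hcost : (G : ℝ) * (s * (P * P + 1)) + G * s * (d + 1) ≤ 3 * τ := by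
    have h1 : (P : ℝ) * P + 1 + (d + 1) ≤ 17 * l ^ 4 := by
      have ha : (P : ℝ) * P ≤ (4 * l ^ 2) * (4 * l ^ 2) := by gcongr
      have hb : l + 2 ≤ l ^ 4 := by
        have : l ^ 4 = l * l ^ 3 := by ring
        have h3 : l ^ 3 = l * (l * l) := by ring
        have h4 : 10 * l ≤ l * l := mul_le_mul_of_nonneg_right hl hl0.le
        have h5 : l * 1 ≤ l * l ^ 3 := mul_le_mul_of_nonneg_left (hp 3) hl0.le
        have h6 : l * 10 ≤ l * (l * l) := mul_le_mul_of_nonneg_left (by linarith) hl0.le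
        have h7 : l * (l * 10) ≤ l * l ^ 3 :=
          mul_le_mul_of_nonneg_left (by linarith) hl0.le
        linarith
      linarith [show (4 * l ^ 2) * (4 * l ^ 2) = 16 * l ^ 4 by ring]
    calc (G : ℝ) * (s * (P * P + 1)) + G * s * (d + 1)
        = G * s * (P * P + 1 + (d + 1)) := by ring
      _ ≤ l * (2 * r) * (17 * l ^ 4) := by gcongr
      _ ≤ 3 * τ := by
          have h2 : l * (2 * r) * (17 * l ^ 4) * (2 * l ^ 2) = 68 * l ^ 7 * r := by ring
          have h3 : 68 * l ^ 7 * r ≤ 3 * m := by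
            rw [← hrr]
            linarith [mul_le_mul_of_nonneg_right hr_ge hr0.le, mul_pos hr0 hr0]
          have h4 : (0 : ℝ) < 2 * l ^ 2 := by positivity
          refine le_of_mul_le_mul_right ?_ h4
          linarith
  have h1n : (100 : ℝ) ≤ n := by linarith
  have main := univMin_le_of_dyadic (n := n) (m := m) (h := 4 * τ) (K := K) (τ := τ) (s := s)
    (P := P) (d := d) (G := G) hK0
    (by
      have : (4 * τ : ℝ) ≤ n := by linarith
      exact_mod_cast this) hτ0 hG hG'
    (by exact (Nat.lt_mul_div_succ _ hnpos).le.trans_eq (mul_comm _ _))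
    (by
      have h2 : (0 : ℝ) ≤ G * (s * (P * P + 1)) := by positivity
      have h3 : 2 * ((G : ℝ) * s * (d + 1)) ≤ n := by linarith
      exact_mod_cast h3)
    (by
      have h3 : (τ : ℝ) + G * (s * (P * P + 1)) + G * s * (d + 1) ≤ 4 * τ := by linarith
      exact_mod_cast h3)
    (by exact (Nat.lt_mul_div_succ _ hτ0).trans_eq (mul_comm _ _))
    (fun g hg => by
      set Δ := 2 * m / (τ + (2 ^ g - 1) * K) with hΔ
      have hΔP : (Δ : ℝ) ≤ 4 * l ^ 2 := by
        refine le_trans ?_ hP_le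
        exact_mod_cast Nat.div_le_div_left (Nat.le_add_right _ _) hτ0
      have hgΔ : (g : ℝ) * Δ ≤ l / 10 := by
        have h1 : Δ * (τ + (2 ^ g - 1) * K) ≤ 2 * m := Nat.div_mul_le_self _ _
        have h2 : g ≤ 2 ^ g - 1 := by
          have := Nat.lt_two_pow_self (n := g)
          omega
        have h3 : g * Δ * K ≤ 2 * m := by
          refine le_trans ?_ h1
          have : g * K ≤ τ + (2 ^ g - 1) * K := (Nat.mul_le_mul_right K h2).trans
            (Nat.le_add_left _ _)
          calc g * Δ * K = Δ * (g * K) := by ring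
            _ ≤ _ := Nat.mul_le_mul_left _ this
        have h4 : (g : ℝ) * Δ * K ≤ 2 * (k * l) := by
          rw [hkl]
          exact_mod_cast h3
        have h5 : (g : ℝ) * Δ * (20 * k) ≤ 2 * (k * l) :=
          le_trans (mul_le_mul_of_nonneg_left hK_ge (by positivity)) h4
        refine le_of_mul_le_mul_left ?_ hk0
        linarith
      have hlogn : Real.log (n + 1) ≤ 2 * l := by
        have h1 : ((n : ℝ) + 1) ≤ m ^ 2 := by
          have h1 : (3 : ℝ) ≤ m := by linarith [hp 14]
          linarith [mul_le_mul_of_nonneg_right h1 hmpos.le, sq (m : ℝ)]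
        calc Real.log (n + 1) ≤ Real.log ((m : ℝ) ^ 2) :=
              Real.log_le_log (by positivity) h1
          _ = 2 * l := by rw [Real.log_pow]; norm_num; rfl
      have hlogn0 : 0 ≤ Real.log ((n : ℝ) + 1) := Real.log_nonneg (by linarith)
      refine dyadic_expansion hl (hlm.trans_eq hexp.symm) (hs_ge.trans' (le_of_eq ?_))
        (hgl g hg) hΔP hgΔ hlogn0 hlogn
      rw [hr, ← hexp, ← Real.exp_half])
  refine main.trans ?_
  push_cast
  have h2 : (k ^ 2 / n + 1) * n = k ^ 2 + n := by field_simp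
  have h3 : (τ : ℝ) * n ≤ k ^ 2 + n := by
    rw [← h2]
    gcongr
  have h4 : (K : ℝ) ^ 2 ≤ (21 * k) ^ 2 := by gcongr
  linarith [mul_pow 21 k 2]

/-! ### Choice of parameters for dense universal graphs -/

theorem eventually_rpow_large {ε : ℝ} (hε : 0 < ε) : ∃ n₀ : ℕ, ∀ n : ℕ, n₀ ≤ n →
    100 ≤ (n : ℝ) ∧ 1 ≤ Real.log n ∧ 36 * Real.log n < (n : ℝ) ^ (ε / 2) ∧
      2000 + 64 / ε ≤ (n : ℝ) ^ ε := by
  have h1 := (isLittleO_log_rpow_atTop (half_pos hε)).bound (show (0 : ℝ) < 1 / 37 by norm_num)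
  have h2 := (tendsto_rpow_atTop hε).eventually_ge_atTop (2000 + 64 / ε)
  have h3 := Real.tendsto_log_atTop.eventually_ge_atTop 1
  obtain ⟨x₀, hx₀⟩ := Filter.eventually_atTop.mp
    (((h1.and h2).and h3).and (Filter.eventually_ge_atTop 100))
  refine ⟨⌈x₀⌉₊, fun n hn => ?_⟩
  obtain ⟨⟨⟨ha, hb⟩, hc⟩, hd⟩ := hx₀ n (Nat.ceil_le.mp hn)
  refine ⟨hd, hc, ?_, hb⟩
  rw [Real.norm_of_nonneg (by linarith), Real.norm_of_nonneg (by positivity)] at ha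
  linarith

theorem exp_neg_le_one_sub_inv_pow {Q P : ℕ} {t : ℝ} (hQ : 2 ≤ Q) (h : 2 * (P : ℝ) ≤ t * Q) :
    Real.exp (-t) ≤ (1 - 1 / (Q : ℝ)) ^ P := by
  have hQ' : (2 : ℝ) ≤ Q := by exact_mod_cast hQ
  have hQ0 : (0 : ℝ) < Q := by linarith
  set p : ℝ := 1 / Q with hp
  have hp0 : 0 < p := by positivity
  have hp2 : p ≤ 1 / 2 := one_div_le_one_div_of_le (by norm_num) hQ'
  have h1 : Real.exp (-(2 * p)) ≤ 1 - p := by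
    rw [Real.exp_neg]
    refine inv_le_of_inv_le₀ (by linarith) ?_
    have h2 : (1 - p)⁻¹ ≤ 1 + 2 * p := by
      rw [inv_le_iff_one_le_mul₀ (by linarith)]
      nlinarith
    linarith [Real.add_one_le_exp (2 * p)]
  calc Real.exp (-t) ≤ Real.exp (-(2 * p)) ^ P := by
        rw [← Real.exp_nat_mul]
        apply Real.exp_le_exp.mpr
        have : 2 * (P : ℝ) * p ≤ t := by
          rw [hp, mul_one_div, div_le_iff₀ hQ0]
          exact h
        linarith
    _ ≤ _ := pow_le_pow_left₀ (Real.exp_pos _).le h1 _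

/-- Used with w = √n, E = n^ε, F = n^(ε/2), L = log n. The bounds on P, x and y make P x + y + 1 at
most 18xy/E, and 36L < F leaves this below xy/F. -/
theorem hubs_expansion {w E F L L' p q : ℝ} {P x y : ℕ} (hF : 0 < F) (hE : E = F * F)
    (hw : 1 ≤ w) (hL : 1 ≤ L) (hLF : 36 * L < F) (hL' : L' ≤ 2 * L)
    (hx : E ≤ x) (hy : w ≤ y) (hP : (P : ℝ) ≤ 16 * (w / E)) (hq : q ≤ L') (hp : 1 / F ≤ p) :
    q + (P * x + y) * L' < p * (x * y) := by
  have hE0 : 0 < E := by rw [hE]; positivity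
  have hx0 : (0 : ℝ) < x := hE0.trans_le hx
  have hy0 : (0 : ℝ) < y := by linarith
  have hxy : (0 : ℝ) < x * y := by positivity
  have h1 : (P : ℝ) * x ≤ 16 * (x * y) / E := by
    calc (P : ℝ) * x ≤ 16 * (y / E) * x := by
          refine mul_le_mul_of_nonneg_right (hP.trans ?_) hx0.le
          gcongr
      _ = _ := by ring
  have h2 : (y : ℝ) ≤ x * y / E := by
    rw [le_div_iff₀ hE0]
    nlinarith
  calc q + (P * x + y) * L' ≤ (P * x + y + 1) * L' := by linarith
    _ ≤ (P * x + y + 1) * (2 * L) := by gcongr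
    _ ≤ (18 * (x * y) / E) * (2 * L) := by
        refine mul_le_mul_of_nonneg_right ?_ (by positivity)
        have h3 : (18 * (x * y) / E : ℝ) = 16 * (x * y) / E + x * y / E + x * y / E := by ring
        linarith
    _ = x * y * (36 * L) / (F * F) := by rw [hE]; ring
    _ < x * y * F / (F * F) := by gcongr
    _ = 1 / F * (x * y) := by field_simp
    _ ≤ p * (x * y) := by gcongr

set_option maxHeartbeats 1000000 in
theorem exists_le_unavoidMax {ε : ℝ} (hε : 0 < ε) (hε4 : ε ≤ 1 / 4) :
    ∃ n₀ : ℕ, ∀ n e m : ℕ, n₀ ≤ n → e + m = n.choose 2 → n * Real.log n < (m : ℝ) →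
      (m : ℝ) < (n : ℝ) ^ (3 / 2 - ε) →
        ε / 1170 * ((n : ℝ) ^ 3 * Real.log n / m) ≤ unavoidMax n e := by
  obtain ⟨n₀, hn₀⟩ := eventually_rpow_large hε
  refine ⟨n₀, fun n e m hn he hm1 hm2 => ?_⟩
  obtain ⟨hn100, hL, hLF, hE⟩ := hn₀ n hn
  set L := Real.log n with hLdef
  have hn0 : (0 : ℝ) < n := by linarith
  obtain ⟨w, hw⟩ : ∃ w, w = Real.sqrt n := ⟨_, rfl⟩
  have hw0 : 0 < w := hw ▸ Real.sqrt_pos.mpr hn0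
  have hww : w * w = n := hw ▸ Real.mul_self_sqrt hn0.le
  have hw1 : 1 ≤ w := hw ▸ Real.one_le_sqrt.mpr (by linarith)
  obtain ⟨F, hF⟩ : ∃ F, F = (n : ℝ) ^ (ε / 2) := ⟨_, rfl⟩
  obtain ⟨E, hEdef⟩ : ∃ E, E = (n : ℝ) ^ ε := ⟨_, rfl⟩
  rw [← hF] at hLF
  rw [← hEdef] at hE
  have hF0 : 0 < F := hF ▸ Real.rpow_pos_of_pos hn0 _
  have hEF : E = F * F := by
    rw [hEdef, hF, ← Real.rpow_add hn0]
    ring_nf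
  have hexp : Real.exp (-(ε * L / 2)) = 1 / F := by
    rw [Real.exp_neg, hF, Real.rpow_def_of_pos hn0, one_div, ← hLdef]
    ring_nf
  have hm2' : (m : ℝ) < n * (w / E) := by
    refine hm2.trans_eq ?_
    rw [show (3 / 2 - ε : ℝ) = 1 + 1 / 2 - ε by ring, Real.rpow_sub hn0, Real.rpow_add hn0,
      Real.rpow_one, ← Real.sqrt_eq_rpow, ← hw, ← hEdef]
    ring
  have h64 : 0 < 64 / ε := by positivity
  have hE2000 : 2000 ≤ E := by linarith
  have hE0 : 0 < E := by linarith
  have hEw : E ≤ w := by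
    rw [hEdef, hw, Real.sqrt_eq_rpow]
    exact Real.rpow_le_rpow_of_exponent_le (by linarith) (by linarith)
  have hm0 : (0 : ℝ) < m := lt_trans (by positivity) hm1
  obtain ⟨u, hu⟩ : ∃ u, u = w / E := ⟨_, rfl⟩
  have huE : u * E = w := by rw [hu]; field_simp
  have hu1 : 1 ≤ u := by
    rw [hu, one_le_div hE0]
    exact hEw
  rw [← hu] at hm2'
  obtain ⟨τ, hτ⟩ : ∃ τ, τ = n / 8 + 1 := ⟨_, rfl⟩
  have hτ_le : (τ : ℝ) ≤ n / 8 + 1 := by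
    rw [hτ]
    push_cast
    have : ((n / 8 : ℕ) : ℝ) ≤ (n : ℝ) / (8 : ℕ) := Nat.cast_div_le
    push_cast at this
    linarith
  have hτ_ge : (n : ℝ) / 8 ≤ τ := by
    have : n ≤ 8 * τ := by omega
    have : (n : ℝ) ≤ 8 * τ := by exact_mod_cast this
    linarith
  have hτ0 : 0 < τ := by omega
  have hτ0' : (0 : ℝ) < τ := by exact_mod_cast hτ0
  obtain ⟨P, hP⟩ : ∃ P, P = 2 * m / τ := ⟨_, rfl⟩
  have hP_le : (P : ℝ) ≤ 16 * (m / n) := by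
    rw [hP]
    refine Nat.cast_div_le.trans ?_
    rw [div_le_iff₀ hτ0']
    push_cast
    calc (2 : ℝ) * m = 16 * (m / n) * (n / 8) := by field_simp; norm_num
      _ ≤ _ := by gcongr
  have hmn : (m : ℝ) / n ≤ u := by
    rw [div_le_iff₀ hn0]
    linarith
  obtain ⟨d, hd⟩ : ∃ d, d = 4 * m / n + 1 := ⟨_, rfl⟩
  have hnpos : 0 < n := by exact_mod_cast hn0
  have hd_le : (d : ℝ) ≤ 5 * u := by
    have h1 : ((4 * m / n : ℕ) : ℝ) ≤ ((4 * m : ℕ) : ℝ) / n := Nat.cast_div_le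
    push_cast at h1
    rw [hd]
    push_cast
    have h2 : (4 * m : ℝ) / n = 4 * (m / n) := by ring
    linarith
  obtain ⟨x, hx⟩ : ∃ x, x = ⌈E⌉₊ := ⟨_, rfl⟩
  have hx_ge : E ≤ x := hx ▸ Nat.le_ceil _
  have hx_le : (x : ℝ) ≤ 2 * E := by
    have := Nat.ceil_lt_add_one hE0.le
    rw [hx]
    linarith
  obtain ⟨y, hy⟩ : ∃ y, y = ⌈w⌉₊ := ⟨_, rfl⟩
  have hy_ge : w ≤ y := hy ▸ Nat.le_ceil _
  have hy_le : (y : ℝ) ≤ 2 * w := by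
    have := Nat.ceil_lt_add_one hw0.le
    rw [hy]
    linarith
  -- Here wu = n^(1-ε), and both the surplus x(P²+1) and the wildcard cost y(d+1) are O(wu), hence
  -- small fractions of n.
  have hwu : 2000 * (w * u) ≤ n := by
    rw [← hww, ← huE]
    have : 0 < u * E * u := by positivity
    linarith [mul_le_mul_of_nonneg_left hE2000 this.le]
  have hcost1 : (x : ℝ) * (P * P + 1) ≤ 514 * (w * u) := by
    have hPu : (P : ℝ) ≤ 16 * u := by linarith
    calc (x : ℝ) * (P * P + 1) ≤ 2 * E * (16 * u * (16 * u) + u * u) := by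
          gcongr
          exact (mul_le_mul hu1 hu1 zero_le_one (by linarith)).trans' (by norm_num)
      _ = 514 * (u * E * u) := by ring
      _ = _ := by rw [huE]
  have hcost2 : (y : ℝ) * (d + 1) ≤ 12 * (w * u) := by
    calc (y : ℝ) * (d + 1) ≤ 2 * w * (6 * u) := by
          gcongr
          linarith
      _ = _ := by ring
  have hwu0 : 0 < w * u := by positivity
  -- With P ≤ 16m/n this makes 2P/Q ≤ (ε/2) log n, so (1 - 1/Q)^P ≥ n^(-ε/2).
  obtain ⟨Q, hQ⟩ : ∃ Q, Q = ⌈64 * m / (ε * (n * L))⌉₊ := ⟨_, rfl⟩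
  have hnL : 0 < (n : ℝ) * L := by positivity
  have hratio : 1 ≤ (m : ℝ) / (ε * (n * L)) := by
    rw [one_le_div (by positivity)]
    calc ε * (n * L) ≤ 1 * (n * L) := by gcongr; linarith
      _ ≤ m := by linarith
  have hQ_ge : 64 * m / (ε * (n * L)) ≤ Q := hQ ▸ Nat.le_ceil _
  have hQ_lt : (Q : ℝ) < 64 * m / (ε * (n * L)) + 1 := hQ ▸ Nat.ceil_lt_add_one (by positivity)
  have h64m : 64 * m / (ε * (n * L)) = 64 * (m / (ε * (n * L))) := by ring
  have hQ_le : (Q : ℝ) ≤ 65 * (m / (ε * (n * L))) := by linarith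
  have hQ2 : 2 ≤ Q := by
    have : (2 : ℝ) ≤ Q := by linarith
    exact_mod_cast this
  have hQn : (Q : ℝ) ≤ n + 1 := by
    have : 64 * m / (ε * (n * L)) ≤ n := by
      rw [div_le_iff₀ (by positivity)]
      have h1 : (64 : ℝ) ≤ ε * E := by
        have : 64 / ε ≤ E := by linarith
        rw [div_le_iff₀ hε] at this
        linarith
      have h2 : (m : ℝ) ≤ n * u := hm2'.le
      have hwn : w ≤ n := hww ▸ le_mul_of_one_le_left hw0.le hw1
      have h3 : u ≤ n := by
        refine le_trans ?_ hwn
        rw [← huE]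
        exact le_mul_of_one_le_right (by linarith) (by linarith)
      calc (64 : ℝ) * m ≤ (ε * E) * (n * u) := by gcongr
        _ = ε * n * (u * E) := by ring
        _ = ε * n * w := by rw [huE]
        _ ≤ ε * n * n := by
            gcongr
        _ ≤ ε * n * n * L := le_mul_of_one_le_right (by positivity) hL
        _ = _ := by ring
    linarith
  have hQ0 : (0 : ℝ) < Q := by linarith [show (2 : ℝ) ≤ Q by exact_mod_cast hQ2]
  have hpow : 1 / F ≤ (1 - 1 / (Q : ℝ)) ^ P := by
    rw [← hexp]
    refine exp_neg_le_one_sub_inv_pow hQ2 ?_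
    calc 2 * (P : ℝ) ≤ 32 * (m / n) := by linarith
      _ = ε * L / 2 * (64 * m / (ε * (n * L))) := by field_simp; norm_num
      _ ≤ _ := by gcongr
  have hhub : (initialVertices n (n - n / 2)).card = n - n / 2 :=
    card_initialVertices (Nat.sub_le _ _)
  have hsub : n - (initialVertices n (n - n / 2)).card = n / 2 := by
    rw [hhub]
    omega
  have hhalf : ((n / 2 : ℕ) : ℝ) ≤ n / 2 := by
    have : ((n / 2 : ℕ) : ℝ) ≤ (n : ℝ) / (2 : ℕ) := Nat.cast_div_le
    simpa using this
  have hhalf' : (n : ℝ) / 2 - 1 / 2 ≤ ((n / 2 : ℕ) : ℝ) := by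
    have : n ≤ 2 * (n / 2) + 1 := by omega
    have : (n : ℝ) ≤ 2 * ((n / 2 : ℕ) : ℝ) + 1 := by exact_mod_cast this
    linarith
  have main := le_unavoidMax_of_hubs he (A := initialVertices n (n - n / 2)) (x := x) (y := y)
    (P := P) (Q := Q) (τ := τ) (d := d) hQ2
    (by
      rw [hd]
      exact (Nat.lt_mul_div_succ _ hnpos).le.trans_eq (mul_comm _ _))
    (by
      have : 2 * ((y : ℝ) * (d + 1)) ≤ n := by linarith
      exact_mod_cast this)
    (by
      rw [hsub]
      have : (τ : ℝ) + (((n / 2 : ℕ) : ℝ) + x * (P * P + 1)) + y * (d + 1) ≤ n := by linarith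
      exact_mod_cast this)
    (by
      rw [hP]
      exact (Nat.lt_mul_div_succ _ hτ0).trans_eq (mul_comm _ _))
    (by
      refine hubs_expansion (w := w) (E := E) (F := F) (L := L) hF0 hEF hw1 hL hLF ?_ hx_ge hy_ge
        ?_ (Real.log_le_log hQ0 hQn) hpow
      · calc Real.log (n + 1) ≤ Real.log ((n : ℝ) ^ 2) :=
              Real.log_le_log (by positivity) (by
                linarith [mul_le_mul_of_nonneg_right hn100 hn0.le, sq (n : ℝ)])
          _ = 2 * L := by rw [Real.log_pow]; norm_num; rfl
      · rw [← hu]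
        linarith)
  refine le_trans ?_ main
  rw [hsub, Nat.cast_choose_two, le_div_iff₀ hQ0]
  have hchoose : (n : ℝ) ^ 2 / 18 ≤ ((n / 2 : ℕ) : ℝ) * (((n / 2 : ℕ) : ℝ) - 1) / 2 := by
    have h1 : (n : ℝ) / 3 ≤ ((n / 2 : ℕ) : ℝ) := by linarith
    have h2 : (n : ℝ) / 3 ≤ ((n / 2 : ℕ) : ℝ) - 1 := by linarith
    have h3 := mul_le_mul h1 h2 (by positivity) (by positivity)
    linarith [show (n : ℝ) / 3 * (n / 3) = n ^ 2 / 9 by ring]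
  refine le_trans ?_ hchoose
  calc ε / 1170 * ((n : ℝ) ^ 3 * L / m) * Q
      ≤ ε / 1170 * ((n : ℝ) ^ 3 * L / m) * (65 * (m / (ε * (n * L)))) := by gcongr
    _ = (n : ℝ) ^ 2 / 18 := by field_simp; norm_num

/-! ### Bounds from counting, and the cases of small parameters -/

/-- Factor by factor, (g - i)/(N - i) ≤ g/N. This turns the ratio of binomials in the counting bound
into a pure power. -/
theorem descFactorial_mul_pow_le {g N : ℕ} (h : g ≤ N) (m : ℕ) :
    g.descFactorial m * N ^ m ≤ N.descFactorial m * g ^ m := by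
  induction m with
  | zero => simp
  | succ m ih =>
    rw [Nat.descFactorial_succ, Nat.descFactorial_succ, pow_succ, pow_succ]
    have h1 : (g - m) * N ≤ (N - m) * g := by
      rw [Nat.sub_mul, Nat.sub_mul, mul_comm N g]
      exact Nat.sub_le_sub_left (Nat.mul_le_mul_left m h) _
    calc (g - m) * g.descFactorial m * (N ^ m * N)
        = (g.descFactorial m * N ^ m) * ((g - m) * N) := by ring
      _ ≤ (N.descFactorial m * g ^ m) * ((N - m) * g) := Nat.mul_le_mul ih h1
      _ = _ := by ring

theorem choose_mul_pow_le {g N : ℕ} (h : g ≤ N) (m : ℕ) :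
    g.choose m * N ^ m ≤ N.choose m * g ^ m := by
  have := descFactorial_mul_pow_le h m
  rw [Nat.descFactorial_eq_factorial_mul_choose, Nat.descFactorial_eq_factorial_mul_choose,
    mul_assoc, mul_assoc] at this
  exact Nat.le_of_mul_le_mul_left this m.factorial_pos

theorem le_numEdges_of_isUniversal {n m : ℕ} (hm : m ≤ n.choose 2) {U : SimpleGraph (Fin n)}
    (hU : IsUniversal n m U) : m ≤ numEdges U := by
  obtain ⟨H, hH⟩ := exists_numEdges_eq hm
  exact hH ▸ numEdges_le_of_isContained (hU H hH)

theorem choose_two_pow_le {n m k : ℕ} (hk : k ≤ n) (hm : m ≤ n.choose 2)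
    {U : SimpleGraph (Fin n)} (hU : IsUniversal n m U) (Z : Finset (Fin n))
    (hZ : ∀ a b, U.Adj a b → a ∈ Z) (hg : numEdges U ≤ k.choose 2) :
    (k.choose 2) ^ m ≤ (Z.card + 1) ^ k * numEdges U ^ m := by
  have h1 := choose_le_of_isUniversal hk hU Z hZ
  have h2 := choose_mul_pow_le hg m
  have h3 := Nat.choose_pos (le_numEdges_of_isUniversal hm hU)
  refine Nat.le_of_mul_le_mul_left ?_ h3
  calc _ ≤ _ := h2
    _ ≤ (Z.card + 1) ^ k * (numEdges U).choose m * numEdges U ^ m := Nat.mul_le_mul_right _ h1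
    _ = _ := by ring

theorem exists_le_univMin_sparse :
    ∃ c : ℝ, 0 < c ∧ ∀ n m : ℕ, m ≤ n.choose 2 → 2 ≤ m → (m : ℝ) ≤ n * Real.log n →
      c * ((m : ℝ) ^ 2 / Real.log m ^ 2) ≤ univMin n m := by
  obtain ⟨m₀, hm₀⟩ := eventually_log_pow_le
  have hlog2 : 0 < Real.log 2 := Real.log_pos one_lt_two
  refine ⟨min (1 / 81) (Real.log 2 ^ 2 / (m₀ + 1)), by positivity, fun n m hm hm2 hmn => ?_⟩
  obtain ⟨U, hU, hUe⟩ := (univMin_isLeast n m).1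
  have hgm := le_numEdges_of_isUniversal hm hU
  rw [← hUe]
  have hm2' : (2 : ℝ) ≤ m := by exact_mod_cast hm2
  have hl2 : Real.log 2 ≤ Real.log m := Real.log_le_log two_pos hm2'
  have hl0 : 0 < Real.log m := hlog2.trans_le hl2
  have hgm' : (m : ℝ) ≤ numEdges U := by exact_mod_cast hgm
  rcases lt_or_ge m m₀ with hlt | hge
  · have hlt' : (m : ℝ) ≤ m₀ + 1 := by
      have : (m : ℝ) < m₀ := by exact_mod_cast hlt
      linarith
    calc (min (1 / 81) (Real.log 2 ^ 2 / (m₀ + 1)) : ℝ) * ((m : ℝ) ^ 2 / Real.log m ^ 2)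
        ≤ Real.log 2 ^ 2 / (m₀ + 1) * ((m : ℝ) ^ 2 / Real.log 2 ^ 2) := by
          gcongr
          exact min_le_right _ _
      _ = (m : ℝ) * ((m : ℝ) / (m₀ + 1)) := by field_simp
      _ ≤ (m : ℝ) * 1 := by
          gcongr
          rw [div_le_one (by positivity)]
          exact hlt'
      _ ≤ (numEdges U : ℝ) := by linarith
  obtain ⟨hl, hlm⟩ := hm₀ m hge
  refine (mul_le_mul_of_nonneg_right (min_le_left _ _) (by positivity)).trans ?_
  rw [← div_pow]
  have hmpos : (0 : ℝ) < m := by linarith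
  have hexp : Real.exp (Real.log m) = m := Real.exp_log hmpos
  obtain ⟨l, hl_def⟩ : ∃ l, l = Real.log m := ⟨_, rfl⟩
  rw [← hl_def] at hl hlm hl0 hexp ⊢
  obtain ⟨k, hk⟩ : ∃ k, k = (m : ℝ) / l := ⟨_, rfl⟩
  rw [← hk]
  have hkl : k * l = m := by rw [hk]; exact div_mul_cancel₀ _ hl0.ne'
  have hk_ge : 100 ≤ k := by
    rw [hk, le_div_iff₀ hl0]
    have h1 : l ^ 14 = l * l ^ 13 := by ring
    have h2 : 1 ≤ l ^ 13 := one_le_pow₀ (by linarith)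
    nlinarith
  -- The hypothesis m ≤ n log n enters here: it provides room for k vertices.
  have hkn : k ≤ n := by
    rcases le_total n m with h | h
    · have h' : (n : ℝ) ≤ m := by exact_mod_cast h
      have hn0 : (0 : ℝ) < n := by
        rcases Nat.eq_zero_or_pos n with h0 | h0
        · rw [h0] at hmn
          simp at hmn
          omega
        · exact_mod_cast h0
      have h1 : Real.log n ≤ l := hl_def ▸ Real.log_le_log hn0 h'
      rw [hk, div_le_iff₀ hl0]
      exact hmn.trans (by gcongr)
    · have h' : (m : ℝ) ≤ n := by exact_mod_cast h
      nlinarith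
  have hκ_le : ((⌊k⌋₊ : ℕ) : ℝ) ≤ k := Nat.floor_le (by linarith)
  have hκ_lt : k < (⌊k⌋₊ : ℕ) + 1 := Nat.lt_floor_add_one k
  obtain ⟨κ, hκ⟩ : ∃ κ, κ = ⌊k⌋₊ := ⟨_, rfl⟩
  rw [← hκ] at hκ_le hκ_lt
  have hκn : κ ≤ n := by
    have : (κ : ℝ) ≤ n := hκ_le.trans hkn
    exact_mod_cast this
  have hN : k ^ 2 / 3 ≤ ((κ.choose 2 : ℕ) : ℝ) := by
    rw [Nat.cast_choose_two]
    have h1 : (k - 1) * (k - 2) ≤ (κ : ℝ) * (κ - 1) :=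
      mul_le_mul (by linarith) (by linarith) (by linarith) (by linarith)
    nlinarith
  by_cases hgN : numEdges U ≤ κ.choose 2
  swap
  · have : ((κ.choose 2 : ℕ) : ℝ) ≤ numEdges U := by exact_mod_cast (not_le.mp hgN).le
    nlinarith
  -- Otherwise U has fewer than 2m² non-isolated vertices, so |Z| + 1 ≤ m³ and the vertex factor is
  -- at most m^(3κ) ≤ e^(3m) ≤ 27^m.
  by_cases hgm2 : m ^ 2 ≤ numEdges U
  · have h1 : (m : ℝ) ^ 2 ≤ numEdges U := by exact_mod_cast hgm2
    have h2 : k ≤ m := by nlinarith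
    have h3 : k ^ 2 ≤ (m : ℝ) ^ 2 := pow_le_pow_left₀ (by linarith) h2 2
    nlinarith
  obtain ⟨Z, hZc, hZ⟩ := exists_support_finset U
  have hpow := choose_two_pow_le hκn hm hU Z hZ hgN
  have hpow' : ((κ.choose 2 : ℕ) : ℝ) ^ m ≤ ((Z.card + 1 : ℕ) : ℝ) ^ κ * (numEdges U : ℝ) ^ m := by
    exact_mod_cast hpow
  have hZ3 : Z.card + 1 ≤ m ^ 3 := by
    have h1 : m ^ 3 = m * m ^ 2 := by ring
    have h2 : 2 * m ^ 2 ≤ m * m ^ 2 := Nat.mul_le_mul_right _ hm2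
    omega
  have hZm : ((Z.card + 1 : ℕ) : ℝ) ≤ (m : ℝ) ^ 3 := by exact_mod_cast hZ3
  have h27 : ((Z.card + 1 : ℕ) : ℝ) ^ κ ≤ 27 ^ m := by
    calc ((Z.card + 1 : ℕ) : ℝ) ^ κ ≤ ((m : ℝ) ^ 3) ^ κ := by gcongr
      _ = Real.exp (3 * (κ * l)) := by
          rw [← hexp, ← pow_mul, ← Real.exp_nat_mul]
          push_cast
          ring_nf
      _ ≤ Real.exp (3 * m) := by
          rw [← hkl]
          gcongr
      _ = (Real.exp 1 ^ 3) ^ m := by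
          rw [← Real.exp_nat_mul, ← Real.exp_nat_mul]
          push_cast
          ring_nf
      _ ≤ 27 ^ m := by
          refine pow_le_pow_left₀ (by positivity) ?_ m
          calc Real.exp 1 ^ 3 ≤ 3 ^ 3 :=
                pow_le_pow_left₀ (Real.exp_pos _).le (Real.exp_one_lt_d9.le.trans (by norm_num)) 3
            _ = 27 := by norm_num
  have h1 : ((κ.choose 2 : ℕ) : ℝ) ^ m ≤ (27 * (numEdges U : ℝ)) ^ m := by
    rw [mul_pow]
    exact hpow'.trans (by gcongr)
  have h2 := le_of_pow_le_pow_left₀ (by omega) (by positivity) h1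
  linarith

/-- For n > 2m the bound at 2m vertices is reused with isolated vertices added; for bounded m the
complete graph suffices. -/
theorem exists_univMin_le_sparse :
    ∃ C : ℝ, 0 < C ∧ ∀ n m : ℕ, 2 ≤ m →
      (univMin n m : ℝ) ≤ C * ((m : ℝ) ^ 2 / Real.log m ^ 2) := by
  obtain ⟨m₀, hm₀⟩ := exists_univMin_le_of_le_two_mul
  refine ⟨4 * (m₀ : ℝ) ^ 2 + 10 ^ 4, by positivity, fun n m hm => ?_⟩
  have hm2 : (2 : ℝ) ≤ m := by exact_mod_cast hm
  have hl0 : 0 < Real.log m := Real.log_pos (by linarith)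
  have main : ∀ n ≤ 2 * m, (univMin n m : ℝ) ≤
      (4 * (m₀ : ℝ) ^ 2 + 10 ^ 4) * ((m : ℝ) ^ 2 / Real.log m ^ 2) := by
    intro n hn
    rcases lt_or_ge m m₀ with h | h
    · have h1 : (univMin n m : ℝ) ≤ (n : ℝ) ^ 2 := by
        exact_mod_cast (univMin_le_choose n m).trans (Nat.choose_le_pow n 2)
      have h2 : (n : ℝ) ^ 2 ≤ (2 * m) ^ 2 :=
        pow_le_pow_left₀ (by positivity) (by exact_mod_cast hn) 2
      have h3 : Real.log m ≤ m₀ := by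
        have h4 : (m : ℝ) ≤ m₀ := by exact_mod_cast h.le
        linarith [Real.log_le_sub_one_of_pos (show (0 : ℝ) < m by linarith)]
      have h5 : Real.log m ^ 2 ≤ (m₀ : ℝ) ^ 2 := pow_le_pow_left₀ hl0.le h3 2
      calc (univMin n m : ℝ) ≤ 4 * (m : ℝ) ^ 2 := by linarith
        _ = 4 * Real.log m ^ 2 * ((m : ℝ) ^ 2 / Real.log m ^ 2) := by field_simp
        _ ≤ _ := by
            refine mul_le_mul_of_nonneg_right ?_ (by positivity)
            linarith
    · refine (hm₀ n m h hn).trans (mul_le_mul_of_nonneg_right ?_ (by positivity))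
      linarith [sq_nonneg (m₀ : ℝ)]
  rcases le_total n (2 * m) with h | h
  · exact main n h
  · exact (Nat.cast_le.mpr (univMin_le_of_le le_rfl h)).trans (main (2 * m) le_rfl)

theorem two_le_of_mul_log_lt {n m : ℕ} (hm : m ≤ n.choose 2) (h : n * Real.log n < (m : ℝ)) :
    2 ≤ n := by
  by_contra hn
  have h1 : n.choose 2 = 0 := Nat.choose_eq_zero_of_lt (by omega)
  have h2 : (0 : ℝ) ≤ n * Real.log n := mul_nonneg (Nat.cast_nonneg _) (Real.log_natCast_nonneg n)
  have h3 : m = 0 := by omega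
  rw [h3, Nat.cast_zero] at h
  linarith

/-- Counting with k = n and N = C(n,2): from e(U) = N - f ≤ N e^(-f/N) follows 1 ≤ (n+1)^n
e^(-fm/N). Then n + 1 ≤ n² and N ≤ n²/2 give the constant 1. -/
theorem unavoidMax_le {n e m : ℕ} (he : e + m = n.choose 2) (hm : n * Real.log n < (m : ℝ)) :
    (unavoidMax n e : ℝ) ≤ (n : ℝ) ^ 3 * Real.log n / m := by
  have hn2 := two_le_of_mul_log_lt (by omega) hm
  have hn2' : (2 : ℝ) ≤ n := by exact_mod_cast hn2
  have hL : 0 < Real.log n := Real.log_pos (by linarith)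
  have hm0 : (0 : ℝ) < m := lt_trans (by positivity) hm
  obtain ⟨U, hU, hUe⟩ := (univMin_isLeast n m).1
  have hdual := univMin_add_unavoidMax he
  rw [← hUe] at hdual
  have hpow := choose_two_pow_le le_rfl (by omega) hU Finset.univ (fun _ _ _ => Finset.mem_univ _)
    (numEdges_le_choose U)
  rw [Finset.card_univ, Fintype.card_fin] at hpow
  obtain ⟨N, hN⟩ : ∃ N : ℝ, N = (n.choose 2 : ℕ) := ⟨_, rfl⟩
  have hdual' : (numEdges U : ℝ) = N - unavoidMax n e := by
    rw [hN, ← hdual]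
    push_cast
    ring
  have hN0 : 0 < N := by
    rw [hN]
    exact_mod_cast Nat.choose_pos hn2
  have hNn : N ≤ (n : ℝ) ^ 2 / 2 := by
    rw [hN, Nat.cast_choose_two]
    nlinarith
  have hpow' : N ^ m ≤ ((n : ℝ) + 1) ^ n * (numEdges U : ℝ) ^ m := by
    rw [hN]
    exact_mod_cast hpow
  obtain ⟨f, hf⟩ : ∃ f : ℝ, f = unavoidMax n e := ⟨_, rfl⟩
  rw [← hf] at hdual' ⊢
  have hgexp : (numEdges U : ℝ) ≤ N * Real.exp (-(f / N)) := by
    have h1 : (numEdges U : ℝ) = N * (1 - f / N) := by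
      rw [hdual']
      field_simp
    rw [h1]
    exact mul_le_mul_of_nonneg_left (Real.one_sub_le_exp_neg _) hN0.le
  have h2 : N ^ m ≤ N ^ m * (((n : ℝ) + 1) ^ n * Real.exp (-(f / N)) ^ m) := by
    calc N ^ m ≤ ((n : ℝ) + 1) ^ n * (N * Real.exp (-(f / N))) ^ m := hpow'.trans (by gcongr)
      _ = _ := by rw [mul_pow]; ring
  have h3 : 1 ≤ ((n : ℝ) + 1) ^ n * Real.exp (-(f / N)) ^ m :=
    le_of_mul_le_mul_left (by rwa [mul_one]) (pow_pos hN0 m)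
  have h4 : ((n : ℝ) + 1) ^ n ≤ Real.exp (n * (2 * Real.log n)) := by
    rw [Real.exp_nat_mul]
    refine pow_le_pow_left₀ (by positivity) ?_ n
    rw [two_mul, Real.exp_add, Real.exp_log (by linarith)]
    nlinarith
  have h5 : 1 ≤ Real.exp (n * (2 * Real.log n) - m * (f / N)) := by
    calc 1 ≤ _ := h3
      _ ≤ Real.exp (n * (2 * Real.log n)) * Real.exp (-(f / N)) ^ m := by gcongr
      _ = _ := by
          rw [← Real.exp_nat_mul, ← Real.exp_add]
          ring_nf
  rw [Real.one_le_exp_iff] at h5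
  have h6 : m * f ≤ n * (2 * Real.log n) * N := by
    have : (m : ℝ) * (f / N) * N = m * f := by field_simp
    rw [← this]
    exact mul_le_mul_of_nonneg_right (by linarith) hN0.le
  rw [le_div_iff₀ hm0]
  calc f * m = m * f := mul_comm _ _
    _ ≤ n * (2 * Real.log n) * N := h6
    _ ≤ n * (2 * Real.log n) * ((n : ℝ) ^ 2 / 2) := by gcongr
    _ = _ := by ring

theorem one_le_unavoidMax {n e : ℕ} (he : e ≤ n.choose 2) (he1 : 1 ≤ e) : 1 ≤ unavoidMax n e := by
  refine (unavoidMax_isGreatest he).2 ⟨2, ⊤, fun G hG => ?_, ?_⟩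
  · have hne : G.edgeSet.Nonempty := by
      by_contra h
      rw [Set.not_nonempty_iff_eq_empty] at h
      rw [numEdges, h, Set.ncard_empty] at hG
      omega
    obtain ⟨p, hp⟩ := hne
    induction p with
    | _ a b =>
      rw [mem_edgeSet] at hp
      refine isContained_iff_exists_injective.mpr ⟨![a, b], ?_, ?_⟩
      · intro i j hij
        fin_cases i <;> fin_cases j <;> simp_all [hp.ne, hp.ne']
      · intro i j hij
        fin_cases i <;> fin_cases j <;> simp_all [hp.symm]
  · rw [numEdges_eq_card, card_edgeFinset_top_fin]
    rfl

theorem exists_le_unavoidMax_dense {ε : ℝ} (hε : 0 < ε) :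
    ∃ c : ℝ, 0 < c ∧ ∀ n e m : ℕ, e + m = n.choose 2 → 1 ≤ e →
      n * Real.log n < (m : ℝ) → (m : ℝ) < (n : ℝ) ^ (3 / 2 - ε) →
        c * ((n : ℝ) ^ 3 * Real.log n / m) ≤ unavoidMax n e := by
  have hδ : 0 < min ε (1 / 4) := by positivity
  obtain ⟨n₀, hn₀⟩ := exists_le_unavoidMax hδ (min_le_right _ _)
  refine ⟨min (min ε (1 / 4) / 1170) (1 / ((n₀ : ℝ) ^ 2 + 1)), by positivity,
    fun n e m he he1 hm1 hm2 => ?_⟩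
  have hn2 := two_le_of_mul_log_lt (by omega) hm1
  have hn2' : (2 : ℝ) ≤ n := by exact_mod_cast hn2
  have hL : 0 < Real.log n := Real.log_pos (by linarith)
  have hm0 : (0 : ℝ) < m := lt_trans (by positivity) hm1
  -- For bounded n a single unavoidable edge is enough, because n log n < m makes the target at most
  -- n².
  rcases lt_or_ge n n₀ with h | h
  · have h1 : (1 : ℝ) ≤ unavoidMax n e := by
      exact_mod_cast one_le_unavoidMax (by omega) he1
    have h2 : (n : ℝ) ^ 3 * Real.log n / m ≤ (n₀ : ℝ) ^ 2 + 1 := by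
      have h3 : (n : ℝ) ^ 3 * Real.log n / m ≤ (n : ℝ) ^ 2 := by
        rw [div_le_iff₀ hm0]
        calc (n : ℝ) ^ 3 * Real.log n = (n : ℝ) ^ 2 * (n * Real.log n) := by ring
          _ ≤ _ := by gcongr
      have h4 : (n : ℝ) ^ 2 ≤ (n₀ : ℝ) ^ 2 :=
        pow_le_pow_left₀ (by positivity) (by exact_mod_cast h.le) 2
      linarith
    calc _ ≤ 1 / ((n₀ : ℝ) ^ 2 + 1) * ((n₀ : ℝ) ^ 2 + 1) :=
          mul_le_mul (min_le_right _ _) h2 (by positivity) (by positivity)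
      _ = 1 := by field_simp
      _ ≤ _ := h1
  · refine (mul_le_mul_of_nonneg_right (min_le_left _ _) (by positivity)).trans
      (hn₀ n e m h he hm1 (hm2.trans_le ?_))
    exact Real.rpow_le_rpow_of_exponent_le (by linarith)
      (by linarith [min_le_left ε (1 / 4)])

/-! ### Assembly of the four estimates through duality -/

theorem theorem1 :
    -- unavoidable graphs, first range
    (∃ c C : ℝ, 0 < c ∧ 0 < C ∧ ∀ n e m : ℕ, e + m = n.choose 2 → 2 ≤ m →
      (m : ℝ) ≤ n * Real.log n →
        c * ((m : ℝ) ^ 2 / Real.log m ^ 2) ≤ (n.choose 2 : ℝ) - unavoidMax n e ∧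
        (n.choose 2 : ℝ) - unavoidMax n e ≤ C * ((m : ℝ) ^ 2 / Real.log m ^ 2)) ∧
    -- unavoidable graphs, second range
    (∀ ε : ℝ, 0 < ε → ∃ c C : ℝ, 0 < c ∧ 0 < C ∧ ∀ n e m : ℕ, e + m = n.choose 2 → 1 ≤ e →
      n * Real.log n < (m : ℝ) → (m : ℝ) < (n : ℝ) ^ (3 / 2 - ε) →
        c * ((n : ℝ) ^ 3 * Real.log n / m) ≤ unavoidMax n e ∧
        (unavoidMax n e : ℝ) ≤ C * ((n : ℝ) ^ 3 * Real.log n / m)) ∧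
    -- universal graphs, first range
    (∃ c C : ℝ, 0 < c ∧ 0 < C ∧ ∀ n m : ℕ, m ≤ n.choose 2 → 2 ≤ m →
      (m : ℝ) ≤ n * Real.log n →
        c * ((m : ℝ) ^ 2 / Real.log m ^ 2) ≤ univMin n m ∧
        (univMin n m : ℝ) ≤ C * ((m : ℝ) ^ 2 / Real.log m ^ 2)) ∧
    -- universal graphs, second range
    (∀ ε : ℝ, 0 < ε → ∃ c C : ℝ, 0 < c ∧ 0 < C ∧ ∀ n m : ℕ, m < n.choose 2 →
      n * Real.log n < (m : ℝ) → (m : ℝ) < (n : ℝ) ^ (3 / 2 - ε) →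
        c * ((n : ℝ) ^ 3 * Real.log n / m) ≤ (n.choose 2 : ℝ) - univMin n m ∧
        (n.choose 2 : ℝ) - univMin n m ≤ C * ((n : ℝ) ^ 3 * Real.log n / m)) := by
  obtain ⟨c₁, hc₁, hlow⟩ := exists_le_univMin_sparse
  obtain ⟨C₁, hC₁, hup⟩ := exists_univMin_le_sparse
  refine ⟨⟨c₁, C₁, hc₁, hC₁, fun n e m he hm hmn => ?_⟩, fun ε hε => ?_,
    ⟨c₁, C₁, hc₁, hC₁, fun n m hm hm2 hmn => ⟨hlow n m hm hm2 hmn, hup n m hm2⟩⟩,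
    fun ε hε => ?_⟩
  · have hdual : ((n.choose 2 : ℕ) : ℝ) = univMin n m + unavoidMax n e := by
      exact_mod_cast (univMin_add_unavoidMax he).symm
    rw [hdual, add_sub_cancel_right]
    exact ⟨hlow n m (by omega) hm hmn, hup n m hm⟩
  · obtain ⟨c, hc, h⟩ := exists_le_unavoidMax_dense hε
    exact ⟨c, 1, hc, one_pos, fun n e m he he1 hm1 hm2 =>
      ⟨h n e m he he1 hm1 hm2, by rw [one_mul]; exact unavoidMax_le he hm1⟩⟩
  · obtain ⟨c, hc, h⟩ := exists_le_unavoidMax_dense hε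
    refine ⟨c, 1, hc, one_pos, fun n m hm hm1 hm2 => ?_⟩
    have he : n.choose 2 - m + m = n.choose 2 := by omega
    have hdual : ((n.choose 2 : ℕ) : ℝ) = univMin n m + unavoidMax n (n.choose 2 - m) := by
      exact_mod_cast (univMin_add_unavoidMax he).symm
    rw [hdual, add_sub_cancel_left, one_mul]
    exact ⟨h n _ m he (by omega) hm1 hm2, unavoidMax_le he hm1⟩
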